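/- Let $A,B$ be finite-dimensional complex Hilbert spaces, let $\{Z_A^j\}_j$ be a finite family of mutually orthogonal projectors on $A$ with $\sum_j Z_A^j=\mathbb 1$ (also written $Z_A^j$ for $Z_A^j\otimes\mathbb 1_B$), let $\Gamma_1,\dots,\Gamma_{m}$ be Hermitian operators on $AB$ and $\gamma_i^{LB},\gamma_i^{UB}\in\mathbb R$. Let $$\mathcal C=\{\rho_{AB}\succeq 0:\ \mathrm{Tr}\,\rho_{AB}=1,\ \gamma_i^{LB}\le \mathrm{Tr}(\rho_{AB}\Gamma_i)\le\gamma_i^{UB}\ \text{for all } i\},$$ and assume $\mathcal C\neq\emptyset$. Write $F(\rho,\sigma)=\big(\mathrm{Tr}\sqrt{\sqrt\rho\,\sigma\sqrt\rho}\big)^2$, and $H_{\min}(X|Y)_\rho=\max_{\sigma_Y}\max\{h\in\mathbb R:\rho_{XY}\preceq 2^{-h}\,\mathbb 1_X\otimes\sigma_Y\}$, with $\sigma_Y$ ranging over density operators. For a purification $|\psi\rangle_{ABE}$ of a density operator $\rho_{AB}$ ($E$ finite-dimensional), $H_{\min}(Z_A|E)$ is the conditional min-entropy of the reduced state on $Z_AE$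 of $V|\psi\rangle$, where $V=\sum_j|j\rangle_{Z_A}\otimes Z_A^j$. 1. For every density operator $\rho_{AB}$ and every purification of it, all maxima below are attained and $$H_{\min}(Z_A|E)=-\log_2\max_{\sigma_{AB}}F\Big(\rho_{AB},\sum_j Z_A^j\sigma_{AB}Z_A^j\Big),$$ the maximum being over density operators $\sigma_{AB}$. 2. The minimum $g=\min_{\rho_{AB}\in\mathcal C}H_{\min}(Z_A|E)$ exists (over states in $\mathcal C$ and their purifications, for any $E$ with $\dim E\ge\dim A\cdot\dim B$; it does not depend on $E$), the following maximum is attained, and $$g=-2\log_2\max_{\rho_{AB}\in\mathcal C}\max_{\sigma_{AB}}\sqrt{F\Big(\rho_{AB},\sum_jZ_A^j\sigma_{AB}Z_A^j\Big)},$$ i.e. $2^{-g/2}$ equals this maximum. 3. $2^{-g/2}$ is the (attained) optimal value of the SDP: maximize $\frac12(\mathrm{Tr}X_{12}+\mathrm{Tr}X_{12}^\dagger)$ subject to $X_{11}\preceq\rho_{AB}$, $X_{22}\preceq\sum_jZ_A^j\sigma_{AB}Z_A^j$, $\gamma_i^{LB}\le\mathrm{Tr}(\rho_{AB}\Gamma_i)\le\gamma_i^{UB}$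 for all $i$, $\mathrm{Tr}\rho_{AB}=\mathrm{Tr}\sigma_{AB}=1$, $\begin{pmatrix}X_{11}&X_{12}\\X_{12}^\dagger&X_{22}\end{pmatrix}\succeq0$, $\rho_{AB}\succeq0$, $\sigma_{AB}\succeq0$. 4. Let $(z,\bar y,x,y,Y_{11},Y_{22})$, with $z,\bar y\in\mathbb R$ and $x,y\in\mathbb R^m$, be any feasible point of the dual SDP: minimize $z+\bar y+\sum_i(y_i\gamma_i^{UB}-x_i\gamma_i^{LB})$ subject to $\sum_i(y_i-x_i)\Gamma_i+\bar y\,\mathbb 1\succeq Y_{11}$, $z\,\mathbb 1\succeq\sum_jZ_A^jY_{22}Z_A^j$, $\begin{pmatrix}Y_{11}&0\\0&Y_{22}\end{pmatrix}\succeq\frac12\begin{pmatrix}0&\mathbb 1\\\mathbb 1&0\end{pmatrix}$, $Y_{11}\succeq0$, $Y_{22}\succeq0$, $x_i,y_i\ge0$. Let $v$ be its objective value. Then $2^{-g/2}\le v$ and $-2\log_2v\le g$; consequently $-2\log_2 v\le H_{\min}(Z_A|E)$ for every $\rho_{AB}\in\mathcal C$ and every purification of it. Moreover, for integers $0<n\le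 N$, $\mathrm{leak}_{EC}\in\mathbb R$ and $\varepsilon_{PA},\varepsilon_{cor}>0$, the key rate $$r(h)=\frac nN\Big\lfloor h-\frac1n\mathrm{leak}_{EC}-\frac2n\log_2\frac1{2\varepsilon_{PA}}-\frac1n\log_2\frac2{\varepsilon_{cor}}\Big\rfloor$$ satisfies $r(-2\log_2v)\le r(H_{\min}(Z_A|E))$. -/

import Mathlib

open scoped Matrix Kronecker ComplexOrder MatrixOrder

noncomputable section

namespace QKD

/-- Normalized density operators on the finite-dimensional space `ℂ^X`. -/
def IsDensity {X : Type*} [Fintype X] (ρ : Matrix X X ℂ) : Prop :=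
  ρ.PosSemidef ∧ ρ.trace = 1

/-- The fidelity `F(ρ, σ) = (Tr √(√ρ σ √ρ))²` of positive semidefinite operators. -/
def fidelity {X : Type*} [Fintype X] [DecidableEq X] (ρ σ : Matrix X X ℂ) : ℝ :=
  ((CFC.sqrt (CFC.sqrt ρ * σ * CFC.sqrt ρ)).trace.re) ^ 2

/-- The real numbers `h` with `ρ_XY ≤ 2^{-h} (1_X ⊗ σ_Y)` for some density operator `σ_Y`. -/
def minEntropyWitnesses {X Y : Type*} [Fintype X] [DecidableEq X] [Fintype Y]
    (ρ : Matrix (X × Y) (X × Y) ℂ) : Set ℝ :=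
  {h | ∃ σ : Matrix Y Y ℂ, IsDensity σ ∧
    ρ ≤ ((2 : ℝ) ^ (-h)) • ((1 : Matrix X X ℂ) ⊗ₖ σ)}

/-- The conditional min-entropy (in bits, optimized over the state of the conditioning system)
`H_min(X|Y)_ρ = max_σ sup {h | ρ_XY ≤ 2^{-h} (1_X ⊗ σ_Y)}`. -/
def condMinEntropy {X Y : Type*} [Fintype X] [DecidableEq X] [Fintype Y]
    (ρ : Matrix (X × Y) (X × Y) ℂ) : ℝ :=
  sSup (minEntropyWitnesses ρ)

/-- A projective measurement: orthogonal projectors `Z^j` with `∑_j Z^j = 1`. -/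
structure IsProjectiveMeasurement {A J : Type*} [Fintype A] [DecidableEq A] [Fintype J]
    (Z : J → Matrix A A ℂ) : Prop where
  isStarProjection : ∀ j, IsStarProjection (Z j)
  mul_eq_zero : ∀ i j, i ≠ j → Z i * Z j = 0
  sum_eq_one : ∑ j, Z j = 1

/-- The operator `Z_A^j`, acting on the joint system `AB`. -/
def onAB {A J : Type*} (B : Type*) [DecidableEq B] (Z : J → Matrix A A ℂ) (j : J) :
    Matrix (A × B) (A × B) ℂ :=
  Z j ⊗ₖ (1 : Matrix B B ℂ)

/-- The map `M ↦ ∑_j Z_A^j M Z_A^j` on operators on `AB`. -/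
def pinch {A B J : Type*} [Fintype A] [Fintype B] [DecidableEq B] [Fintype J]
    (Z : J → Matrix A A ℂ) (M : Matrix (A × B) (A × B) ℂ) : Matrix (A × B) (A × B) ℂ :=
  ∑ j, onAB B Z j * M * onAB B Z j

/-- The key-map isometry `V = ∑_j |j⟩ ⊗ Z_A^j` from `AB` to `Z_A AB`. -/
def keyIsometry {A J : Type*} (B : Type*) [DecidableEq B] (Z : J → Matrix A A ℂ) :
    Matrix (J × (A × B)) (A × B) ℂ :=
  Matrix.of fun p x => onAB B Z p.1 p.2 x

/-- The rank-one operator `|ψ⟩⟨ψ|`. -/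
def pureState {X : Type*} (ψ : X → ℂ) : Matrix X X ℂ :=
  Matrix.vecMulVec ψ (star ψ)

/-- The partial trace over the second factor. -/
def traceRight {X Y : Type*} [Fintype Y] (M : Matrix (X × Y) (X × Y) ℂ) : Matrix X X ℂ :=
  Matrix.of fun x x' => ∑ y, M (x, y) (x', y)

/-- The partial trace over the middle factor. -/
def traceMiddle {W X Y : Type*} [Fintype X] (M : Matrix ((W × X) × Y) ((W × X) × Y) ℂ) :
    Matrix (W × Y) (W × Y) ℂ :=
  Matrix.of fun p q => ∑ x, M ((p.1, x), p.2) ((q.1, x), q.2)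

/-- The vector `ψ` of the system `X E` purifies the state `ρ_X`. -/
def IsPurification {X E : Type*} [Fintype E] (ψ : X × E → ℂ) (ρ : Matrix X X ℂ) : Prop :=
  traceRight (pureState ψ) = ρ

/-- The state of `Z_A E`: apply the key-map isometry to the pure state `|ψ⟩⟨ψ|` of `ABE`
and trace out `AB`. -/
def keyEveState {A B J E : Type*} [Fintype A] [Fintype B] [DecidableEq B]
    [Fintype E] [DecidableEq E] (Z : J → Matrix A A ℂ) (ψ : (A × B) × E → ℂ) :
    Matrix (J × E) (J × E) ℂ :=
  traceMiddle ((keyIsometry B Z ⊗ₖ (1 : Matrix E E ℂ)) * pureState ψ *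
    (keyIsometry B Z ⊗ₖ (1 : Matrix E E ℂ))ᴴ)

/-- `H_min(Z_A|E)` for the pure state `ψ` of `ABE`. -/
def keyMinEntropy {A B J E : Type*} [Fintype A] [Fintype B] [DecidableEq B]
    [Fintype J] [DecidableEq J] [Fintype E] [DecidableEq E]
    (Z : J → Matrix A A ℂ) (ψ : (A × B) × E → ℂ) : ℝ :=
  condMinEntropy (keyEveState Z ψ)

/-- The set of density operators `ρ` with `γLB_i ≤ Tr(ρ Γ_i) ≤ γUB_i` for all `i`. -/
def constraintSet {X ι : Type*} [Fintype X] (Γ : ι → Matrix X X ℂ) (γLB γUB : ι → ℝ) :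
    Set (Matrix X X ℂ) :=
  {ρ | IsDensity ρ ∧ ∀ i, γLB i ≤ (ρ * Γ i).trace.re ∧ (ρ * Γ i).trace.re ≤ γUB i}

/-- All values of `H_min(Z_A|E)` for states `ρ_AB` in `C` purified by the system `E`. -/
def keyMinEntropyValues {A B J : Type*} [Fintype A] [Fintype B] [DecidableEq B]
    [Fintype J] [DecidableEq J] (E : Type*) [Fintype E] [DecidableEq E]
    (Z : J → Matrix A A ℂ) (C : Set (Matrix (A × B) (A × B) ℂ)) : Set ℝ :=
  {h | ∃ ρ ∈ C, ∃ ψ : (A × B) × E → ℂ, IsPurification ψ ρ ∧ h = keyMinEntropy Z ψ}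

/-- Feasible points of the primal semidefinite program. -/
structure PrimalFeasible {A B J ι : Type*} [Fintype A] [Fintype B]
    [DecidableEq B] [Fintype J]
    (Z : J → Matrix A A ℂ) (Γ : ι → Matrix (A × B) (A × B) ℂ) (γLB γUB : ι → ℝ)
    (ρ σ X₁₁ X₁₂ X₂₂ : Matrix (A × B) (A × B) ℂ) : Prop where
  le_rho : X₁₁ ≤ ρ
  le_pinch : X₂₂ ≤ pinch Z σ
  upper : ∀ i, (ρ * Γ i).trace.re ≤ γUB i
  lower : ∀ i, γLB i ≤ (ρ * Γ i).trace.re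
  trace_rho : ρ.trace = 1
  trace_sigma : σ.trace = 1
  block : 0 ≤ Matrix.fromBlocks X₁₁ X₁₂ X₁₂ᴴ X₂₂
  rho_nonneg : 0 ≤ ρ
  sigma_nonneg : 0 ≤ σ

/-- The primal objective `(Tr X₁₂ + Tr X₁₂†) / 2`. -/
def primalObjective {X : Type*} [Fintype X] (X₁₂ : Matrix X X ℂ) : ℝ :=
  ((1 / 2 : ℂ) * (X₁₂.trace + X₁₂ᴴ.trace)).re

/-- Feasible points of the dual semidefinite program. -/
structure DualFeasible {A B J ι : Type*} [Fintype A] [DecidableEq A] [Fintype B]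
    [DecidableEq B] [Fintype J] [Fintype ι]
    (Z : J → Matrix A A ℂ) (Γ : ι → Matrix (A × B) (A × B) ℂ)
    (z ybar : ℝ) (x y : ι → ℝ) (Y₁₁ Y₂₂ : Matrix (A × B) (A × B) ℂ) : Prop where
  le_sum : Y₁₁ ≤ ∑ i, (y i - x i) • Γ i + ybar • (1 : Matrix (A × B) (A × B) ℂ)
  pinch_le : pinch Z Y₂₂ ≤ z • (1 : Matrix (A × B) (A × B) ℂ)
  block : (1 / 2 : ℝ) • Matrix.fromBlocks 0 1 1 0 ≤ Matrix.fromBlocks Y₁₁ 0 0 Y₂₂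
  Y₁₁_nonneg : 0 ≤ Y₁₁
  Y₂₂_nonneg : 0 ≤ Y₂₂
  y_nonneg : ∀ i, 0 ≤ y i
  x_nonneg : ∀ i, 0 ≤ x i

/-- The dual objective `z + ȳ + ∑_i (y_i γUB_i - x_i γLB_i)`. -/
def dualObjective {ι : Type*} [Fintype ι] (γLB γUB : ι → ℝ) (z ybar : ℝ) (x y : ι → ℝ) : ℝ :=
  z + ybar + ∑ i, (y i * γUB i - x i * γLB i)

/-- The min-entropy secret key rate per transmission as a function of the min-entropy `h`,
for `N` transmitted signals of which `n` are used for the key, error-correction leakage `leak`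
(in bits), and privacy-amplification and correctness parameters `εPA`, `εcor`. -/
def keyRate (n N : ℕ) (leak εPA εcor h : ℝ) : ℝ :=
  (n / N : ℝ) * (⌊h - 1 / n * leak - 2 / n * Real.logb 2 (1 / (2 * εPA))
    - 1 / n * Real.logb 2 (2 / εcor)⌋ : ℤ)

end QKD

end

/-!
Writing a purification of `ρ` as a coefficient matrix `K` with `K * Kᴴ = ρ`, the state of `Z_A E`
is block diagonal with blocks `Kᴴ * P j * K` up to a transposition, where `P j` is `Z j` acting on
`AB`. Hence `2 ^ (-H_min(Z_A|E))` is the least `l` with `Kᴴ * P j * K ≤ l • τ` for all `j` and some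
density operator `τ`, and it has to be matched with the largest fidelity of `ρ` with a pinched
state.

The root fidelity of `ρ` and `σ` is the largest `Re Tr X` over the positive semidefinite block
matrices with diagonal blocks `ρ` and `σ` and corner `X`, and such corners are `√ρ * V * √σ` for
contractions `V`. For any feasible `(l, τ)`, Douglas' factorization of the constraints and the
Cauchy–Schwarz inequality bound the fidelity by `l`. Conversely, a measurement `M` on `E` maximizing
the guessing probability `∑ j, Tr (Kᴴ * P j * K * M j)` satisfies first-order conditions that make
the Hermitian part of `∑ j, Kᴴ * P j * K * M j` a feasible `l • τ` with `l` the guessing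
probability, and `∑ j, P j * K * M j * Kᴴ * P j` normalizes to a pinched state attaining the bound.
-/

namespace QKD

open Matrix

section Loewner

variable {𝕜 m n : Type*} [RCLike 𝕜] [Fintype m]

theorem conjTranspose_mul_mul_mono [Finite n] {A B : Matrix m m 𝕜} (h : A ≤ B) (C : Matrix m n 𝕜) :
    Cᴴ * A * C ≤ Cᴴ * B * C := by
  have hC := (Matrix.le_iff.mp h).conjTranspose_mul_mul_same C
  rwa [Matrix.mul_sub, Matrix.sub_mul, ← Matrix.le_iff] at hC

theorem mul_mul_conjTranspose_mono [Finite n] {A B : Matrix m m 𝕜} (h : A ≤ B)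
    (C : Matrix n m 𝕜) : C * A * Cᴴ ≤ C * B * Cᴴ := by
  simpa only [conjTranspose_conjTranspose] using conjTranspose_mul_mul_mono h Cᴴ

theorem trace_mono {A B : Matrix m m 𝕜} (h : A ≤ B) : A.trace ≤ B.trace := by
  have hBA := (Matrix.le_iff.mp h).trace_nonneg
  rwa [trace_sub, sub_nonneg] at hBA

theorem trace_mul_nonneg {A B : Matrix m m 𝕜} (hA : A.PosSemidef) (hB : B.PosSemidef) :
    0 ≤ (A * B).trace := by
  classical
  obtain ⟨C, rfl⟩ := CStarAlgebra.nonneg_iff_eq_star_mul_self.mp hB.nonneg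
  rw [star_eq_conjTranspose, ← Matrix.mul_assoc, trace_mul_comm, ← Matrix.mul_assoc]
  exact (hA.mul_mul_conjTranspose_same C).trace_nonneg

theorem trace_mul_mono {A B C : Matrix m m 𝕜} (h : A ≤ B) (hC : C.PosSemidef) :
    (A * C).trace ≤ (B * C).trace := by
  have hBA := trace_mul_nonneg (Matrix.le_iff.mp h) hC
  rwa [Matrix.sub_mul, trace_sub, sub_nonneg] at hBA

/- Both conditions are equivalent to positivity of the block matrix with diagonal blocks `1` and
off-diagonal block `V`. -/
theorem mul_conjTranspose_self_le_one [Fintype n] [DecidableEq m] [DecidableEq n]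
    {V : Matrix m n 𝕜} (hV : Vᴴ * V ≤ 1) : V * Vᴴ ≤ 1 := by
  have := invertibleOne (α := Matrix m m 𝕜)
  have := invertibleOne (α := Matrix n n 𝕜)
  have hblock : (fromBlocks 1 V Vᴴ 1).PosSemidef :=
    (PosDef.fromBlocks₁₁ V 1 PosDef.one).mpr (by simpa [← Matrix.le_iff] using hV)
  simpa [Matrix.le_iff] using (PosDef.fromBlocks₂₂ 1 V PosDef.one).mp hblock

theorem conjTranspose_mul_self_mul_le_one {l : Type*} [Fintype l] [Finite n] [DecidableEq m]
    [DecidableEq n] {V : Matrix l m 𝕜} {W : Matrix m n 𝕜} (hV : Vᴴ * V ≤ 1) (hW : Wᴴ * W ≤ 1) :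
    (V * W)ᴴ * (V * W) ≤ 1 :=
  calc (V * W)ᴴ * (V * W) = Wᴴ * (Vᴴ * V) * W := by
        simp only [conjTranspose_mul, Matrix.mul_assoc]
    _ ≤ Wᴴ * 1 * W := conjTranspose_mul_mul_mono hV W
    _ ≤ 1 := by rwa [Matrix.mul_one]

end Loewner

section Douglas

variable {𝕜 l m n : Type*} [RCLike 𝕜] [Fintype l] [Fintype m]

theorem exists_hermitian_generalizedInverse {S : Matrix m m 𝕜} (hS : S.IsHermitian) :
    ∃ T : Matrix m m 𝕜, T.IsHermitian ∧ S * T * S = S ∧ T * S * T = T := by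
  classical
  have hcont (f : ℝ → ℝ) : ContinuousOn f (spectrum ℝ S) := S.finite_real_spectrum.continuousOn f
  have hinv (x : ℝ) : x⁻¹ * x * x⁻¹ = x⁻¹ := by simpa only [inv_inv] using mul_inv_mul_cancel x⁻¹
  have hid : cfc (fun x : ℝ => x) S = S := cfc_id' ℝ S hS
  have hSTS : cfc (fun x : ℝ => x) S * cfc (fun x : ℝ => x⁻¹) S * cfc (fun x : ℝ => x) S =
      cfc (fun x : ℝ => x) S := by
    simp only [← cfc_mul _ _ S (hcont _) (hcont _), mul_inv_mul_cancel]
  have hTST : cfc (fun x : ℝ => x⁻¹) S * cfc (fun x : ℝ => x) S * cfc (fun x : ℝ => x⁻¹) S =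
      cfc (fun x : ℝ => x⁻¹) S := by
    simp only [← cfc_mul _ _ S (hcont _) (hcont _), hinv]
  rw [hid] at hSTS hTST
  exact ⟨_, cfc_predicate (R := ℝ) (p := IsSelfAdjoint) _ S, hSTS, hTST⟩

/- Douglas' factorization lemma: with a generalized inverse `T` of `Bᴴ * B`, the factor is
`A * T * Bᴴ`. -/
theorem exists_contraction_mul_eq [Finite n] [DecidableEq l] {A : Matrix m n 𝕜} {B : Matrix l n 𝕜}
    (h : Aᴴ * A ≤ Bᴴ * B) : ∃ V : Matrix m l 𝕜, Vᴴ * V ≤ 1 ∧ V * B = A := by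
  have := Fintype.ofFinite n
  classical
  obtain ⟨T, hT, hSTS, hTST⟩ :=
    exists_hermitian_generalizedInverse (isHermitian_conjTranspose_mul_self B)
  set S := Bᴴ * B with hS
  refine ⟨A * T * Bᴴ, ?_, ?_⟩
  · have hproj : IsStarProjection (B * T * Bᴴ) := by
      refine ⟨?_, ?_⟩
      · calc B * T * Bᴴ * (B * T * Bᴴ) = B * (T * S * T) * Bᴴ := by
              simp only [hS, Matrix.mul_assoc]
          _ = B * T * Bᴴ := by rw [hTST]
      · simp only [IsSelfAdjoint, star_eq_conjTranspose, conjTranspose_mul, hT.eq,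
          conjTranspose_conjTranspose, Matrix.mul_assoc]
    calc (A * T * Bᴴ)ᴴ * (A * T * Bᴴ) = (B * T) * (Aᴴ * A) * (B * T)ᴴ := by
          simp only [conjTranspose_mul, hT.eq, conjTranspose_conjTranspose, Matrix.mul_assoc]
      _ ≤ (B * T) * S * (B * T)ᴴ := mul_mul_conjTranspose_mono h _
      _ = B * (T * S * T) * Bᴴ := by
          simp only [conjTranspose_mul, hT.eq, Matrix.mul_assoc]
      _ = B * T * Bᴴ := by rw [hTST]
      _ ≤ 1 := hproj.le_one
  · have hzero : A * (1 - T * S) = 0 := by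
      rw [← conjTranspose_mul_self_eq_zero]
      refine le_antisymm ?_ (posSemidef_conjTranspose_mul_self _).nonneg
      calc (A * (1 - T * S))ᴴ * (A * (1 - T * S))
          = (1 - T * S)ᴴ * (Aᴴ * A) * (1 - T * S) := by
            simp only [conjTranspose_mul, Matrix.mul_assoc]
        _ ≤ (1 - T * S)ᴴ * S * (1 - T * S) := conjTranspose_mul_mul_mono h _
        _ = (1 - T * S)ᴴ * (S - S * T * S) := by
            rw [Matrix.mul_assoc, Matrix.mul_sub, Matrix.mul_one, Matrix.mul_assoc S]
        _ = 0 := by rw [hSTS, sub_self, Matrix.mul_zero]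
    rw [Matrix.mul_sub, Matrix.mul_one, sub_eq_zero] at hzero
    rw [Matrix.mul_assoc, Matrix.mul_assoc, ← hS, ← hzero]

variable [Fintype n] [DecidableEq n]

theorem conjTranspose_sqrt (P : Matrix n n 𝕜) : (CFC.sqrt P)ᴴ = CFC.sqrt P :=
  (CFC.sqrt_nonneg P).posSemidef.isHermitian

theorem exists_polar_decomposition (M : Matrix m n 𝕜) :
    ∃ U : Matrix m n 𝕜, Uᴴ * U ≤ 1 ∧ U * CFC.sqrt (Mᴴ * M) = M ∧
      Uᴴ * M = CFC.sqrt (Mᴴ * M) := by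
  set S := CFC.sqrt (Mᴴ * M)
  have hS : Sᴴ = S := conjTranspose_sqrt _
  have hSS : S * S = Mᴴ * M :=
    CFC.sqrt_mul_sqrt_self _ (posSemidef_conjTranspose_mul_self M).nonneg
  obtain ⟨U, hU, hUS⟩ := exists_contraction_mul_eq (A := M) (B := S) (by rw [hS, hSS])
  obtain ⟨D, hD⟩ := CStarAlgebra.nonneg_iff_eq_star_mul_self.mp (sub_nonneg.mpr hU)
  rw [star_eq_conjTranspose] at hD
  have hDS : D * S = 0 := by
    rw [← conjTranspose_mul_self_eq_zero]
    calc (D * S)ᴴ * (D * S) = S * (Dᴴ * D) * S := by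
          simp only [conjTranspose_mul, hS, Matrix.mul_assoc]
      _ = S * S - (U * S)ᴴ * (U * S) := by
          rw [← hD]
          simp only [Matrix.mul_sub, Matrix.sub_mul, Matrix.mul_one, conjTranspose_mul, hS,
            Matrix.mul_assoc]
      _ = 0 := by rw [hUS, hSS, sub_self]
  have hUUS : (1 - Uᴴ * U) * S = 0 := by rw [hD, Matrix.mul_assoc, hDS, Matrix.mul_zero]
  rw [Matrix.sub_mul, Matrix.one_mul, sub_eq_zero, Matrix.mul_assoc, hUS] at hUUS
  exact ⟨U, hU, hUS, hUUS.symm⟩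

end Douglas

section Block

variable {𝕜 k l m n : Type*} [RCLike 𝕜]

theorem posSemidef_fromBlocks_iff_exists_gram [Fintype m] [Fintype n] {P : Matrix m m 𝕜}
    {X : Matrix m n 𝕜} {Q : Matrix n n 𝕜} :
    (fromBlocks P X Xᴴ Q).PosSemidef ↔
      ∃ (G : Matrix (m ⊕ n) m 𝕜) (H : Matrix (m ⊕ n) n 𝕜),
        P = Gᴴ * G ∧ X = Gᴴ * H ∧ Q = Hᴴ * H := by
  classical
  constructor
  · intro h
    obtain ⟨C, hC⟩ := CStarAlgebra.nonneg_iff_eq_star_mul_self.mp h.nonneg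
    rw [star_eq_conjTranspose, ← fromCols_toCols C,
      conjTranspose_fromCols_eq_fromRows_conjTranspose, fromRows_mul_fromCols, fromBlocks_inj] at hC
    exact ⟨_, _, hC.1, hC.2.1, hC.2.2.2⟩
  · rintro ⟨G, H, rfl, rfl, rfl⟩
    rw [conjTranspose_mul, conjTranspose_conjTranspose, ← fromRows_mul_fromCols,
      ← conjTranspose_fromCols_eq_fromRows_conjTranspose]
    exact posSemidef_conjTranspose_mul_self _

theorem posSemidef_fromBlocks_gram_iff [Fintype k] [Fintype l] [DecidableEq l] [Finite m] [Finite n]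
    {A : Matrix k m 𝕜} {X : Matrix m n 𝕜} {B : Matrix l n 𝕜} :
    (fromBlocks (Aᴴ * A) X Xᴴ (Bᴴ * B)).PosSemidef ↔
      ∃ V : Matrix k l 𝕜, Vᴴ * V ≤ 1 ∧ X = Aᴴ * V * B := by
  have := Fintype.ofFinite m
  have := Fintype.ofFinite n
  classical
  constructor
  · intro h
    obtain ⟨G, H, hG, rfl, hH⟩ := posSemidef_fromBlocks_iff_exists_gram.mp h
    obtain ⟨V, hV, rfl⟩ := exists_contraction_mul_eq hG.ge
    obtain ⟨W, hW, rfl⟩ := exists_contraction_mul_eq hH.ge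
    have hV' : Vᴴᴴ * Vᴴ ≤ 1 := by
      simpa only [conjTranspose_conjTranspose] using mul_conjTranspose_self_le_one hV
    exact ⟨Vᴴ * W, conjTranspose_mul_self_mul_le_one hV' hW, by
      simp only [conjTranspose_mul, Matrix.mul_assoc]⟩
  · rintro ⟨V, hV, rfl⟩
    have := invertibleOne (α := Matrix k k 𝕜)
    have hblock : (fromBlocks 1 V Vᴴ 1).PosSemidef :=
      (PosDef.fromBlocks₁₁ V 1 PosDef.one).mpr (by simpa [← Matrix.le_iff] using hV)
    simpa [fromBlocks_conjTranspose, fromBlocks_multiply, Matrix.mul_assoc] using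
      hblock.conjTranspose_mul_mul_same (fromBlocks A 0 0 B)

theorem posSemidef_fromBlocks_iff_exists_contraction [Fintype m] [Fintype n] [DecidableEq m]
    [DecidableEq n] {P : Matrix m m 𝕜} {X : Matrix m n 𝕜} {Q : Matrix n n 𝕜}
    (hP : P.PosSemidef) (hQ : Q.PosSemidef) :
    (fromBlocks P X Xᴴ Q).PosSemidef ↔
      ∃ V : Matrix m n 𝕜, Vᴴ * V ≤ 1 ∧ X = CFC.sqrt P * V * CFC.sqrt Q := by
  simpa only [conjTranspose_sqrt, CFC.sqrt_mul_sqrt_self P hP.nonneg,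
    CFC.sqrt_mul_sqrt_self Q hQ.nonneg] using
    posSemidef_fromBlocks_gram_iff (A := CFC.sqrt P) (X := X) (B := CFC.sqrt Q)

end Block

section Fidelity

variable {m n : Type*} [Fintype m] [Fintype n]

theorem re_trace_conjTranspose_mul_le (A B : Matrix m n ℂ) :
    (Aᴴ * B).trace.re ≤ √(Aᴴ * A).trace.re * √(Bᴴ * B).trace.re := by
  have hA : 0 ≤ (Aᴴ * A).trace.re :=
    Complex.re_le_re (posSemidef_conjTranspose_mul_self A).trace_nonneg
  have hBA : (Bᴴ * A).trace.re = (Aᴴ * B).trace.re := by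
    rw [← Complex.conj_re, starRingEnd_apply, ← trace_conjTranspose, conjTranspose_mul,
      conjTranspose_conjTranspose]
  have hquad (t : ℝ) : 0 ≤ (Aᴴ * A).trace.re * (t * t) + -2 * (Aᴴ * B).trace.re * t +
      (Bᴴ * B).trace.re := by
    have h := Complex.re_le_re (posSemidef_conjTranspose_mul_self (t • A - B)).trace_nonneg
    simp only [conjTranspose_sub, conjTranspose_smul, star_trivial, Matrix.sub_mul, Matrix.mul_sub,
      Matrix.smul_mul, Matrix.mul_smul, trace_sub, trace_smul, Complex.sub_re, Complex.smul_re,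
      smul_eq_mul, hBA, Complex.zero_re] at h
    linarith
  rw [← Real.sqrt_mul hA]
  refine (le_abs_self _).trans (Real.abs_le_sqrt ?_)
  have hdiscrim := discrim_le_zero hquad
  rw [discrim] at hdiscrim
  linarith

variable [DecidableEq n]

theorem re_trace_contraction_mul_le {V S : Matrix n n ℂ} (hV : Vᴴ * V ≤ 1) (hS : S.PosSemidef) :
    (V * S).trace.re ≤ S.trace.re := by
  obtain ⟨R, rfl⟩ := CStarAlgebra.nonneg_iff_eq_star_mul_self.mp hS.nonneg
  rw [star_eq_conjTranspose] at hS ⊢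
  have hle : (V * Rᴴ)ᴴ * (V * Rᴴ) ≤ R * Rᴴ :=
    calc (V * Rᴴ)ᴴ * (V * Rᴴ) = R * (Vᴴ * V) * Rᴴ := by
          simp only [conjTranspose_mul, conjTranspose_conjTranspose, Matrix.mul_assoc]
      _ ≤ R * 1 * Rᴴ := mul_mul_conjTranspose_mono hV R
      _ = R * Rᴴ := by rw [Matrix.mul_one]
  calc (V * (Rᴴ * R)).trace.re = (Rᴴᴴ * (V * Rᴴ)).trace.re := by
        rw [conjTranspose_conjTranspose, trace_mul_comm R, Matrix.mul_assoc]
    _ ≤ √(Rᴴᴴ * Rᴴ).trace.re * √((V * Rᴴ)ᴴ * (V * Rᴴ)).trace.re :=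
        re_trace_conjTranspose_mul_le Rᴴ (V * Rᴴ)
    _ ≤ √(R * Rᴴ).trace.re * √(R * Rᴴ).trace.re := by
        rw [conjTranspose_conjTranspose]
        gcongr
        exact trace_mono hle
    _ = (Rᴴ * R).trace.re := by
        rw [trace_mul_comm, Real.mul_self_sqrt (Complex.re_le_re hS.trace_nonneg)]

theorem sqrt_fidelity (ρ σ : Matrix n n ℂ) :
    √(fidelity ρ σ) = (CFC.sqrt (CFC.sqrt ρ * σ * CFC.sqrt ρ)).trace.re :=
  Real.sqrt_sq (Complex.re_le_re (CFC.sqrt_nonneg _).posSemidef.trace_nonneg)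

/- The trace of `√ρ * V * √σ` is maximal for the adjoint of the polar factor of `√σ * √ρ`. -/
theorem isGreatest_sqrt_fidelity {ρ σ : Matrix n n ℂ} (hρ : ρ.PosSemidef) (hσ : σ.PosSemidef) :
    IsGreatest {f | ∃ X, (fromBlocks ρ X Xᴴ σ).PosSemidef ∧ f = X.trace.re}
      (√(fidelity ρ σ)) := by
  have htrace (V : Matrix n n ℂ) :
      (CFC.sqrt ρ * V * CFC.sqrt σ).trace = (V * (CFC.sqrt σ * CFC.sqrt ρ)).trace := by
    rw [trace_mul_cycle, trace_mul_comm]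
  have hgram : (CFC.sqrt σ * CFC.sqrt ρ)ᴴ * (CFC.sqrt σ * CFC.sqrt ρ) =
      CFC.sqrt ρ * σ * CFC.sqrt ρ := by
    rw [conjTranspose_mul, conjTranspose_sqrt, conjTranspose_sqrt, Matrix.mul_assoc,
      ← Matrix.mul_assoc (CFC.sqrt σ), CFC.sqrt_mul_sqrt_self σ hσ.nonneg, Matrix.mul_assoc]
  obtain ⟨U, hU, hUS, hUM⟩ := exists_polar_decomposition (CFC.sqrt σ * CFC.sqrt ρ)
  rw [hgram] at hUS hUM
  rw [sqrt_fidelity]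
  refine ⟨⟨_, (posSemidef_fromBlocks_iff_exists_contraction hρ hσ).mpr ⟨Uᴴ, ?_, rfl⟩,
    by rw [htrace, hUM]⟩, ?_⟩
  · rw [conjTranspose_conjTranspose]
    exact mul_conjTranspose_self_le_one hU
  · rintro _ ⟨X, hX, rfl⟩
    obtain ⟨V, hV, rfl⟩ := (posSemidef_fromBlocks_iff_exists_contraction hρ hσ).mp hX
    rw [htrace, ← hUS, ← Matrix.mul_assoc]
    exact re_trace_contraction_mul_le (conjTranspose_mul_self_mul_le_one hV hU)
      (CFC.sqrt_nonneg _).posSemidef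

end Fidelity

section Compactness

variable {n : Type*}

open scoped Matrix.Norms.L2Operator in
theorem isCompact_Icc_zero_one [Finite n] [DecidableEq n] :
    IsCompact (Set.Icc (0 : Matrix n n ℂ) 1) := by
  have := Fintype.ofFinite n
  have := FiniteDimensional.proper ℂ (Matrix n n ℂ)
  refine Metric.isCompact_of_isClosed_isBounded isClosed_Icc
    ((Metric.isBounded_closedBall (x := 0) (r := 1)).subset fun M hM => ?_)
  rw [mem_closedBall_zero_iff]
  exact (CStarAlgebra.norm_le_one_iff_of_nonneg M hM.1).mpr hM.2

variable [Fintype n]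

theorem le_re_trace_smul_one [DecidableEq n] {M : Matrix n n ℂ} (hM : M.PosSemidef) :
    M ≤ M.trace.re • (1 : Matrix n n ℂ) := by
  rw [← Algebra.algebraMap_eq_smul_one]
  refine le_algebraMap_of_spectrum_le (R := ℝ) ?_ hM.isHermitian
  rw [hM.isHermitian.spectrum_real_eq_range_eigenvalues]
  rintro _ ⟨i, rfl⟩
  rw [hM.isHermitian.trace_eq_sum_eigenvalues, Complex.re_sum]
  exact Finset.single_le_sum (fun i _ => hM.eigenvalues_nonneg i) (Finset.mem_univ i)

theorem posSemidef_of_forall_isStarProjection {M : Matrix n n ℂ} (hM : M.IsHermitian)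
    (h : ∀ P : Matrix n n ℂ, IsStarProjection P → 0 ≤ (M * P).trace.re) : M.PosSemidef := by
  classical
  rw [hM.posSemidef_iff_eigenvalues_nonneg]
  intro i
  set v : n → ℂ := ⇑(hM.eigenvectorBasis i)
  have hv : star v ⬝ᵥ v = 1 := by
    have := hM.eigenvectorBasis.inner_eq_one i
    rwa [EuclideanSpace.inner_eq_star_dotProduct, dotProduct_comm] at this
  have hP : IsStarProjection (vecMulVec v (star v)) := by
    refine ⟨?_, ?_⟩
    · rw [IsIdempotentElem, vecMulVec_mul_vecMulVec, hv, one_smul]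
    · exact (posSemidef_vecMulVec_self_star v).isHermitian
  have htrace : (M * vecMulVec v (star v)).trace = star v ⬝ᵥ M *ᵥ v := by
    rw [mul_vecMulVec, trace_vecMulVec, dotProduct_comm]
  change 0 ≤ hM.eigenvalues i
  rw [hM.eigenvalues_eq]
  exact (h _ hP).trans_eq (congrArg Complex.re htrace)

end Compactness

section POVM

/-- A measurement (POVM) on the system `E`: a family of positive semidefinite effects, indexed by
the outcomes, that sums to the identity. The min-entropy of a classical system given `E` is governed
by how well such a measurement guesses it. -/
structure IsPOVM {J E : Type*} [Fintype J] [DecidableEq E] (M : J → Matrix E E ℂ) : Prop where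
  nonneg : ∀ j, 0 ≤ M j
  sum_eq_one : ∑ j, M j = 1

variable {J E : Type*} [Fintype J] [DecidableEq E] {M : J → Matrix E E ℂ}

theorem IsPOVM.le_one (hM : IsPOVM M) (j : J) : M j ≤ 1 :=
  hM.sum_eq_one ▸ Finset.single_le_sum (fun i _ => hM.nonneg i) (Finset.mem_univ j)

open scoped Matrix.Norms.L2Operator in
theorem isCompact_setOf_isPOVM [Finite E] : IsCompact {M : J → Matrix E E ℂ | IsPOVM M} := by
  have := Fintype.ofFinite E
  refine (isCompact_univ_pi fun _ : J => isCompact_Icc_zero_one).of_isClosed_subset ?_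
    fun M hM j _ => ⟨hM.nonneg j, hM.le_one j⟩
  have hset : {M : J → Matrix E E ℂ | IsPOVM M} = {M | ∀ j, 0 ≤ M j} ∩ {M | ∑ j, M j = 1} :=
    Set.ext fun M => ⟨fun h => ⟨h.nonneg, h.sum_eq_one⟩, fun h => ⟨h.1, h.2⟩⟩
  rw [hset]
  refine IsClosed.inter ?_ (isClosed_eq (by fun_prop) continuous_const)
  rw [Set.ofPred_forall]
  exact isClosed_iInter fun j => isClosed_le continuous_const (continuous_apply j)

theorem isPOVM_single [Finite E] [DecidableEq J] (k : J) :
    IsPOVM (Pi.single k (1 : Matrix E E ℂ)) where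
  nonneg :=
    have := Fintype.ofFinite E
    Pi.single_nonneg (α := fun _ : J => Matrix E E ℂ).mpr zero_le_one
  sum_eq_one := by simp

variable [Fintype E]

theorem exists_optimal_isPOVM [Nonempty J] (T : J → Matrix E E ℂ) :
    ∃ M, IsPOVM M ∧
      ∀ N, IsPOVM N → ∑ j, (T j * N j).trace.re ≤ ∑ j, (T j * M j).trace.re := by
  classical
  obtain ⟨M, hM, hmax⟩ := isCompact_setOf_isPOVM.exists_isMaxOn
    ⟨_, isPOVM_single (J := J) (E := E) (Classical.arbitrary J)⟩
    (f := fun M => ∑ j, (T j * M j).trace.re) (by fun_prop)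
  exact ⟨M, hM, fun N hN => hmax hN⟩

theorem IsPOVM.conj_add_single [DecidableEq J] (hM : IsPOVM M) {Q : Matrix E E ℂ}
    (hQ : Qᴴ * Q ≤ 1) (k : J) :
    IsPOVM fun j => Qᴴ * M j * Q + Pi.single (M := fun _ => Matrix E E ℂ) k (1 - Qᴴ * Q) j where
  nonneg j := add_nonneg
    ((hM.nonneg j).posSemidef.conjTranspose_mul_mul_same Q).nonneg
    (Pi.single_nonneg (α := fun _ : J => Matrix E E ℂ).mpr (sub_nonneg.mpr hQ) j)
  sum_eq_one := by
    rw [Finset.sum_add_distrib, ← Finset.sum_mul, ← Finset.mul_sum, hM.sum_eq_one,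
      Matrix.mul_one, Finset.sum_pi_single', if_pos (Finset.mem_univ k), add_sub_cancel]

theorem nonpos_of_forall_mul_add_mul_sq_nonpos {a b : ℝ}
    (h : ∀ s ∈ Set.Ioc (0 : ℝ) 1, a * s + b * s ^ 2 ≤ 0) : a ≤ 0 := by
  have hlim : Filter.Tendsto (fun s : ℝ => a + b * s) (nhdsWithin 0 (Set.Ioi 0)) (nhds a) := by
    have hcont : Continuous fun s : ℝ => a + b * s := by fun_prop
    simpa using (hcont.tendsto 0).mono_left nhdsWithin_le_nhds
  refine le_of_tendsto hlim ?_
  filter_upwards [Ioc_mem_nhdsGT one_pos] with s hs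
  nlinarith [h s hs, hs.1]

/- Perturb the optimal measurement `M` to the one with effects `Q * M j * Q + δ_{jk} (1 - Q * Q)`,
where `Q = 1 - s • P` with small `s > 0`: to first order, weight in the direction `P` is shifted
to the outcome `k`. -/
theorem IsPOVM.two_mul_re_trace_le_of_optimal {T : J → Matrix E E ℂ} (hM : IsPOVM M)
    (hmax : ∀ N, IsPOVM N → ∑ j, (T j * N j).trace.re ≤ ∑ j, (T j * M j).trace.re)
    {P : Matrix E E ℂ} (hP : IsStarProjection P) (k : J) :
    2 * (T k * P).trace.re ≤ ∑ j, (T j * (M j * P + P * M j)).trace.re := by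
  classical
  rw [← sub_nonpos]
  refine nonpos_of_forall_mul_add_mul_sq_nonpos
    (b := ∑ j, (T j * (P * M j * P)).trace.re - (T k * P).trace.re) fun s hs => ?_
  set Q : Matrix E E ℂ := 1 - s • P with hQ
  have hQH : Qᴴ = Q := by
    rw [hQ, conjTranspose_sub, conjTranspose_one, conjTranspose_smul, star_trivial,
      ← star_eq_conjTranspose, hP.isSelfAdjoint.star_eq]
  have hQQ : 1 - Qᴴ * Q = (2 * s - s ^ 2) • P := by
    rw [hQH, hQ]
    simp only [Matrix.sub_mul, Matrix.mul_sub, Matrix.one_mul, Matrix.mul_one, smul_mul_assoc,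
      mul_smul_comm, hP.isIdempotentElem.eq]
    module
  have hQ1 : Qᴴ * Q ≤ 1 := by
    rw [← sub_nonneg, hQQ]
    exact smul_nonneg (by nlinarith [hs.1, hs.2]) hP.nonneg
  have hQMQ (j : J) : Qᴴ * M j * Q = M j - s • (M j * P + P * M j) + s ^ 2 • (P * M j * P) := by
    rw [hQH, hQ]
    simp only [Matrix.sub_mul, Matrix.mul_sub, Matrix.one_mul, Matrix.mul_one, smul_mul_assoc,
      mul_smul_comm]
    module
  have hscore := hmax _ (hM.conj_add_single hQ1 k)
  have hsingle : ∑ j, (T j * Pi.single (M := fun _ => Matrix E E ℂ) k (1 - Qᴴ * Q) j).trace.re =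
      (2 * s - s ^ 2) * (T k * P).trace.re := by
    rw [Fintype.sum_eq_single k fun j hj => by rw [Pi.single_eq_of_ne hj, Matrix.mul_zero,
      trace_zero, Complex.zero_re], Pi.single_eq_same, hQQ, mul_smul_comm, trace_smul,
      Complex.smul_re, smul_eq_mul]
  simp only [Matrix.mul_add, Matrix.mul_sub, mul_smul_comm, trace_add, trace_sub, trace_smul,
    Complex.add_re, Complex.sub_re, Complex.smul_re, smul_eq_mul, hQMQ, Finset.sum_add_distrib,
    Finset.sum_sub_distrib, ← Finset.mul_sum, hsingle] at hscore ⊢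
  linarith

/- The first-order optimality condition of the best measurement `M` says that the symmetrized
`∑ j, T j * M j` dominates every `T k`. -/
theorem exists_guessing_dual [Nonempty J] {T : J → Matrix E E ℂ} (hT : ∀ j, (T j).IsHermitian) :
    ∃ (M : J → Matrix E E ℂ) (τ : Matrix E E ℂ), IsPOVM M ∧ (∀ j, T j ≤ τ) ∧
      τ.trace = ∑ j, (T j * M j).trace := by
  obtain ⟨M, hM, hmax⟩ := exists_optimal_isPOVM T
  have hMH (j : J) : (M j)ᴴ = M j := (hM.nonneg j).posSemidef.isHermitian
  set τ : Matrix E E ℂ := (1 / 2 : ℝ) • ∑ j, (T j * M j + M j * T j) with hτ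
  have hτH : τᴴ = τ := by
    simp only [hτ, conjTranspose_smul, star_trivial, conjTranspose_sum, conjTranspose_add,
      conjTranspose_mul, hMH, (hT _).eq, add_comm]
  refine ⟨M, τ, hM, fun k => ?_, ?_⟩
  · refine posSemidef_of_forall_isStarProjection (IsHermitian.sub hτH (hT k)) fun P hP => ?_
    have hfirst := hM.two_mul_re_trace_le_of_optimal hmax hP k
    have hτP : 2 * (τ * P).trace.re = ∑ j, (T j * (M j * P + P * M j)).trace.re := by
      have hcycle (j : J) : (M j * T j * P).trace = (T j * (P * M j)).trace := by
        rw [Matrix.mul_assoc, trace_mul_comm, Matrix.mul_assoc]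
      simp only [hτ, smul_mul_assoc, Finset.sum_mul, Matrix.add_mul, Matrix.mul_add, trace_smul,
        trace_sum, trace_add, hcycle, Complex.smul_re, Complex.re_sum, Matrix.mul_assoc (T _)]
      rw [smul_eq_mul, ← mul_assoc]
      norm_num
    rw [Matrix.sub_mul, trace_sub, Complex.sub_re]
    linarith
  · have hcomm (j : J) : (M j * T j).trace = (T j * M j).trace := trace_mul_comm _ _
    simp only [hτ, trace_smul, trace_sum, trace_add, hcomm, ← two_mul, ← Finset.mul_sum]
    rw [Complex.real_smul, ← mul_assoc]
    norm_num

end POVM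

section Pinching

/-- The pinching `M ↦ ∑ j, P j * M * P j` by a family of projections on an arbitrary system; `pinch`
is the case of the projections `onAB B Z`. -/
def pinching {X J : Type*} [Fintype X] [Fintype J] (P : J → Matrix X X ℂ) (M : Matrix X X ℂ) :
    Matrix X X ℂ :=
  ∑ j, P j * M * P j

variable {X J : Type*} [Fintype X] [Fintype J]

theorem trace_pinching_mul (P : J → Matrix X X ℂ) (M N : Matrix X X ℂ) :
    (pinching P M * N).trace = (M * pinching P N).trace := by
  simp only [pinching, Matrix.sum_mul, Matrix.mul_sum, trace_sum]
  refine Finset.sum_congr rfl fun j _ => ?_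
  rw [Matrix.mul_assoc, Matrix.mul_assoc, trace_mul_comm]
  simp only [Matrix.mul_assoc]

variable [DecidableEq X] {P : J → Matrix X X ℂ}

theorem IsProjectiveMeasurement.conjTranspose_eq (hP : IsProjectiveMeasurement P) (j : J) :
    (P j)ᴴ = P j :=
  (hP.isStarProjection j).isSelfAdjoint

theorem IsProjectiveMeasurement.mul_self_eq (hP : IsProjectiveMeasurement P) (j : J) :
    P j * P j = P j :=
  (hP.isStarProjection j).isIdempotentElem

theorem IsProjectiveMeasurement.mul_sum_eq {E : Type*} (hP : IsProjectiveMeasurement P)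
    (V : J → Matrix X E ℂ) (k : J) : P k * ∑ j, P j * V j = P k * V k := by
  rw [Matrix.mul_sum, Finset.sum_eq_single k]
  · rw [← Matrix.mul_assoc, hP.mul_self_eq]
  · intro j _ hjk
    rw [← Matrix.mul_assoc, hP.mul_eq_zero k j hjk.symm, Matrix.zero_mul]
  · simp

theorem IsProjectiveMeasurement.trace_mul_mul (hP : IsProjectiveMeasurement P) (M : Matrix X X ℂ)
    (j : J) : (P j * M * P j).trace = (M * P j).trace := by
  rw [Matrix.mul_assoc, trace_mul_comm, Matrix.mul_assoc, hP.mul_self_eq]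

theorem IsProjectiveMeasurement.trace_pinching (hP : IsProjectiveMeasurement P)
    (M : Matrix X X ℂ) : (pinching P M).trace = M.trace := by
  simp only [pinching, trace_sum, hP.trace_mul_mul]
  rw [← trace_sum, ← Matrix.mul_sum, hP.sum_eq_one, Matrix.mul_one]

theorem IsProjectiveMeasurement.posSemidef_mul_mul (hP : IsProjectiveMeasurement P)
    {M : Matrix X X ℂ} (hM : M.PosSemidef) (j : J) : (P j * M * P j).PosSemidef := by
  simpa only [hP.conjTranspose_eq] using hM.conjTranspose_mul_mul_same (P j)

theorem IsProjectiveMeasurement.posSemidef_pinching (hP : IsProjectiveMeasurement P)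
    {M : Matrix X X ℂ} (hM : M.PosSemidef) : (pinching P M).PosSemidef :=
  posSemidef_sum _ fun j _ => hP.posSemidef_mul_mul hM j

end Pinching

section WeakDuality

variable {X J E : Type*} [Fintype X] [DecidableEq X] [Fintype J] [Fintype E]
  {P : J → Matrix X X ℂ} {K : Matrix X E ℂ} {σ : Matrix X X ℂ}

theorem IsProjectiveMeasurement.trace_conj_pinching_le [DecidableEq E]
    (hP : IsProjectiveMeasurement P) {V : J → Matrix X E ℂ} (hV : ∀ j, (V j)ᴴ * V j ≤ 1)
    (hσ : σ.PosSemidef) :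
    ((∑ j, P j * V j)ᴴ * pinching P σ * ∑ j, P j * V j).trace ≤ σ.trace := by
  have hconj : (∑ j, P j * V j)ᴴ * pinching P σ * ∑ j, P j * V j =
      ∑ j, (V j)ᴴ * (P j * σ * P j) * V j := by
    rw [pinching, Matrix.mul_assoc, Matrix.sum_mul, Matrix.mul_sum]
    refine Finset.sum_congr rfl fun k _ => ?_
    rw [← Matrix.mul_assoc]
    have hk := hP.mul_sum_eq V k
    calc (∑ j, P j * V j)ᴴ * (P k * σ * P k) * ∑ j, P j * V j
        = (P k * ∑ j, P j * V j)ᴴ * σ * (P k * ∑ j, P j * V j) := by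
          simp only [conjTranspose_mul, hP.conjTranspose_eq, Matrix.mul_assoc]
      _ = (V k)ᴴ * (P k * σ * P k) * V k := by
          simp only [hk, conjTranspose_mul, hP.conjTranspose_eq, Matrix.mul_assoc]
  rw [hconj, ← hP.trace_pinching σ, pinching, trace_sum, trace_sum]
  refine Finset.sum_le_sum fun j _ => ?_
  calc ((V j)ᴴ * (P j * σ * P j) * V j).trace = (V j * (V j)ᴴ * (P j * σ * P j)).trace := by
        rw [trace_mul_comm, ← Matrix.mul_assoc]
    _ ≤ (1 * (P j * σ * P j)).trace :=
        trace_mul_mono (mul_conjTranspose_self_le_one (hV j)) (hP.posSemidef_mul_mul hσ j)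
    _ = (P j * σ * P j).trace := by rw [Matrix.one_mul]

/- Douglas' lemma gives contractions `V j` with `V j * R = P j * K`; take `W = ∑ j, P j * V j`. -/
theorem IsProjectiveMeasurement.exists_mul_eq_of_conj_le (hP : IsProjectiveMeasurement P)
    {R : Matrix E E ℂ} (hK : ∀ j, Kᴴ * P j * K ≤ Rᴴ * R) :
    ∃ W : Matrix X E ℂ, W * R = K ∧
      ∀ σ : Matrix X X ℂ, σ.PosSemidef → (Wᴴ * pinching P σ * W).trace ≤ σ.trace := by
  classical
  have hPK (j : J) : (P j * K)ᴴ * (P j * K) ≤ Rᴴ * R := by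
    rw [conjTranspose_mul, hP.conjTranspose_eq, Matrix.mul_assoc, ← Matrix.mul_assoc (P j),
      hP.mul_self_eq, ← Matrix.mul_assoc]
    exact hK j
  choose V hV hVR using fun j => exists_contraction_mul_eq (hPK j)
  refine ⟨∑ j, P j * V j, ?_, fun σ hσ => hP.trace_conj_pinching_le hV hσ⟩
  simp only [Matrix.sum_mul, Matrix.mul_assoc, hVR]
  simp only [← Matrix.mul_assoc, hP.mul_self_eq]
  rw [← Matrix.sum_mul, hP.sum_eq_one, Matrix.one_mul]

/- With `K = W * R` and `Y = K * U * ω`, this is Cauchy–Schwarz for `Uᴴ * Rᴴ` and `ω * W`. -/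
theorem IsProjectiveMeasurement.re_trace_le_sqrt (hP : IsProjectiveMeasurement P) {l : ℝ}
    (hl : 0 ≤ l) {τ : Matrix E E ℂ} (hτ : IsDensity τ) (hK : ∀ j, Kᴴ * P j * K ≤ l • τ)
    (hσ : IsDensity σ) {Y : Matrix X X ℂ}
    (hY : (fromBlocks (K * Kᴴ) Y Yᴴ (pinching P σ)).PosSemidef) : Y.trace.re ≤ √l := by
  classical
  obtain ⟨R, hR⟩ := CStarAlgebra.nonneg_iff_eq_star_mul_self.mp (smul_nonneg hl hτ.1.nonneg)
  obtain ⟨ω, hω⟩ := CStarAlgebra.nonneg_iff_eq_star_mul_self.mp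
    (hP.posSemidef_pinching hσ.1).nonneg
  rw [star_eq_conjTranspose] at hR hω
  obtain ⟨W, rfl, hW⟩ := hP.exists_mul_eq_of_conj_le fun j => (hK j).trans_eq hR
  rw [hω, ← conjTranspose_conjTranspose (W * R), conjTranspose_conjTranspose (W * R)ᴴ] at hY
  obtain ⟨U, hU, rfl⟩ := posSemidef_fromBlocks_gram_iff.mp hY
  have hUR : ((Uᴴ * Rᴴ)ᴴ * (Uᴴ * Rᴴ)).trace.re ≤ l := by
    have hle : R * (U * Uᴴ) * Rᴴ ≤ R * 1 * Rᴴ :=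
      mul_mul_conjTranspose_mono (mul_conjTranspose_self_le_one hU) R
    have htrace := Complex.re_le_re (trace_mono hle)
    rw [Matrix.mul_one, trace_mul_comm R, ← hR, trace_smul, hτ.2, Complex.real_smul, mul_one,
      Complex.ofReal_re] at htrace
    simpa only [conjTranspose_mul, conjTranspose_conjTranspose, Matrix.mul_assoc] using htrace
  have hωW : ((ω * W)ᴴ * (ω * W)).trace.re ≤ 1 := by
    have htrace := Complex.re_le_re (hW σ hσ.1)
    rw [hω, hσ.2, Complex.one_re] at htrace
    simpa only [conjTranspose_mul, Matrix.mul_assoc] using htrace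
  calc ((W * R)ᴴᴴ * U * ω).trace.re = ((Uᴴ * Rᴴ)ᴴ * (ω * W)).trace.re := by
        simp only [conjTranspose_mul, conjTranspose_conjTranspose, Matrix.mul_assoc]
        rw [trace_mul_comm W]
        simp only [Matrix.mul_assoc]
    _ ≤ √((Uᴴ * Rᴴ)ᴴ * (Uᴴ * Rᴴ)).trace.re * √((ω * W)ᴴ * (ω * W)).trace.re :=
        re_trace_conjTranspose_mul_le _ _
    _ ≤ √l * √1 := by gcongr
    _ = √l := by rw [Real.sqrt_one, mul_one]

end WeakDuality

section StrongDuality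

variable {X J E : Type*} [Fintype X] [DecidableEq X] [Fintype J] [Fintype E]
  {P : J → Matrix X X ℂ} {K : Matrix X E ℂ}

theorem posSemidef_fromBlocks_sum {𝕜 m n ι : Type*} [RCLike 𝕜] [Fintype m] [Finite n]
    (s : Finset ι) {N : ι → Matrix m m 𝕜} (hN : ∀ i, (N i).PosSemidef) (Q : ι → Matrix m n 𝕜) :
    (fromBlocks (∑ i ∈ s, N i) (∑ i ∈ s, N i * Q i) (∑ i ∈ s, N i * Q i)ᴴ
      (∑ i ∈ s, (Q i)ᴴ * N i * Q i)).PosSemidef := by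
  have := Fintype.ofFinite n
  classical
  convert posSemidef_sum s fun i _ =>
    (hN i).conjTranspose_mul_mul_same (fromCols (1 : Matrix m m 𝕜) (Q i))
  simp only [conjTranspose_fromCols_eq_fromRows_conjTranspose, fromRows_mul, mul_fromCols,
    fromCols_fromRows_eq_fromBlocks, conjTranspose_sum, conjTranspose_mul,
    (hN _).isHermitian.eq, conjTranspose_one, Matrix.one_mul, Matrix.mul_one]
  ext (i | i) (j | j) <;> simp only [fromBlocks_apply₁₁, fromBlocks_apply₁₂, fromBlocks_apply₂₁,
    fromBlocks_apply₂₂, Matrix.sum_apply]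

theorem isDensity_inv_smul {n : Type*} [Fintype n] {τ : Matrix n n ℂ} (hτ : τ.PosSemidef) {p : ℝ}
    (hp : 0 < p) (htr : τ.trace = p) : IsDensity (p⁻¹ • τ) := by
  refine ⟨hτ.smul (inv_nonneg.mpr hp.le), ?_⟩
  rw [trace_smul, htr, Complex.real_smul, ← Complex.ofReal_mul, inv_mul_cancel₀ hp.ne',
    Complex.ofReal_one]

theorem IsProjectiveMeasurement.pinching_sum_mul_mul (hP : IsProjectiveMeasurement P)
    (N : J → Matrix X X ℂ) :
    pinching P (∑ j, P j * N j * P j) = ∑ j, P j * N j * P j := by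
  refine Finset.sum_congr rfl fun k _ => ?_
  simp only [Matrix.mul_assoc, hP.mul_sum_eq]
  rw [hP.mul_self_eq]

/- The off-diagonal block is proportional to `∑ j, K * M j * Kᴴ * P j`. -/
theorem IsProjectiveMeasurement.exists_posSemidef_fromBlocks [DecidableEq E]
    (hP : IsProjectiveMeasurement P) {M : J → Matrix E E ℂ} (hM : IsPOVM M) {p : ℝ} (hp : 0 < p)
    (hp_eq : ∑ j, (Kᴴ * P j * K * M j).trace = p) :
    ∃ σ Y : Matrix X X ℂ, IsDensity σ ∧
      (fromBlocks (K * Kᴴ) Y Yᴴ (pinching P σ)).PosSemidef ∧ Y.trace = √p := by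
  set N : J → Matrix X X ℂ := fun j => K * M j * Kᴴ
  have hN (j : J) : (N j).PosSemidef := (hM.nonneg j).posSemidef.mul_mul_conjTranspose_same K
  have hN_sum : ∑ j, N j = K * Kᴴ := by
    rw [← Matrix.sum_mul, ← Matrix.mul_sum, hM.sum_eq_one, Matrix.mul_one]
  have hN_trace : ∑ j, (N j * P j).trace = p := by
    rw [← hp_eq]
    refine Finset.sum_congr rfl fun j _ => ?_
    rw [trace_mul_cycle _ K, trace_mul_cycle _ _ K, ← Matrix.mul_assoc]
  set ω : Matrix X X ℂ := ∑ j, P j * N j * P j with hω_def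
  have hω_trace : ω.trace = p := by
    simpa only [hω_def, trace_sum, hP.trace_mul_mul] using hN_trace
  have hω : ω.PosSemidef := posSemidef_sum _ fun j _ => hP.posSemidef_mul_mul (hN j) j
  have hω_pinching : pinching P (p⁻¹ • ω) = p⁻¹ • ω := by
    rw [hω_def, Finset.smul_sum]
    simpa only [Matrix.mul_smul, Matrix.smul_mul] using
      hP.pinching_sum_mul_mul fun j => p⁻¹ • N j
  refine ⟨p⁻¹ • ω, (√p)⁻¹ • ∑ j, N j * P j, isDensity_inv_smul hω hp hω_trace, ?_, ?_⟩
  · have hblock := posSemidef_fromBlocks_sum Finset.univ hN fun j => (√p)⁻¹ • P j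
    simp only [Matrix.mul_smul, Matrix.smul_mul, conjTranspose_smul, hP.conjTranspose_eq,
      star_trivial, smul_smul, ← mul_inv, Real.mul_self_sqrt hp.le, ← Finset.smul_sum,
      hN_sum] at hblock
    rwa [hω_pinching, conjTranspose_smul, star_trivial]
  · rw [trace_smul, trace_sum, hN_trace, Complex.real_smul, ← Complex.ofReal_mul,
      inv_mul_eq_div, Real.div_sqrt]

theorem IsProjectiveMeasurement.fidelity_pinching_le (hP : IsProjectiveMeasurement P) {l : ℝ}
    (hl : 0 ≤ l) {τ : Matrix E E ℂ} (hτ : IsDensity τ) (hK : ∀ j, Kᴴ * P j * K ≤ l • τ)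
    {σ : Matrix X X ℂ} (hσ : IsDensity σ) : fidelity (K * Kᴴ) (pinching P σ) ≤ l := by
  obtain ⟨Y, hY, hF⟩ := (isGreatest_sqrt_fidelity (posSemidef_self_mul_conjTranspose K)
    (hP.posSemidef_pinching hσ.1)).1
  exact (Real.sqrt_le_sqrt_iff hl).mp (hF.trans_le (hP.re_trace_le_sqrt hl hτ hK hσ hY))

theorem IsProjectiveMeasurement.exists_pos_guessing_dual [DecidableEq E]
    (hP : IsProjectiveMeasurement P) (hK : IsDensity (K * Kᴴ)) :
    ∃ (M : J → Matrix E E ℂ) (τ : Matrix E E ℂ) (p : ℝ), 0 < p ∧ IsPOVM M ∧ IsDensity τ ∧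
      (∀ j, Kᴴ * P j * K ≤ p • τ) ∧ ∑ j, (Kᴴ * P j * K * M j).trace = p := by
  classical
  have hT (j : J) : (Kᴴ * P j * K).PosSemidef := by
    have hPj := hP.posSemidef_mul_mul PosSemidef.one j
    rw [Matrix.mul_one, hP.mul_self_eq] at hPj
    exact hPj.conjTranspose_mul_mul_same K
  have hT_sum : ∑ j, (Kᴴ * P j * K).trace = 1 := by
    rw [← trace_sum, ← Matrix.sum_mul, ← Matrix.mul_sum, hP.sum_eq_one, Matrix.mul_one,
      trace_mul_comm, hK.2]
  obtain ⟨k, -, hk⟩ := Finset.exists_ne_zero_of_sum_ne_zero (hT_sum.trans_ne one_ne_zero)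
  have : Nonempty J := ⟨k⟩
  obtain ⟨M, τ, hM, hle, htr⟩ := exists_guessing_dual fun j => (hT j).isHermitian
  have hτ : τ.PosSemidef := ((hT k).nonneg.trans (hle k)).posSemidef
  have hτ_pos : 0 < τ.trace :=
    ((hT k).trace_nonneg.lt_of_ne hk.symm).trans_le (trace_mono (hle k))
  obtain ⟨p, hp, hp_eq⟩ := RCLike.pos_iff_exists_ofReal.mp hτ_pos
  refine ⟨M, p⁻¹ • τ, p, hp, hM, isDensity_inv_smul hτ hp hp_eq.symm, fun j => ?_,
    htr.symm.trans hp_eq.symm⟩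
  rw [smul_inv_smul₀ hp.ne']
  exact hle j

theorem IsProjectiveMeasurement.exists_isGreatest_fidelity_pinching
    (hP : IsProjectiveMeasurement P) (hK : IsDensity (K * Kᴴ)) :
    ∃ p : ℝ, 0 < p ∧
      IsGreatest {f | ∃ σ, IsDensity σ ∧ f = fidelity (K * Kᴴ) (pinching P σ)} p ∧
      IsLeast {l | 0 ≤ l ∧ ∃ τ, IsDensity τ ∧ ∀ j, Kᴴ * P j * K ≤ l • τ} p := by
  classical
  obtain ⟨M, τ, p, hp, hM, hτ, hle, hp_eq⟩ := hP.exists_pos_guessing_dual hK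
  obtain ⟨σ, Y, hσ, hblock, hY⟩ := hP.exists_posSemidef_fromBlocks hM hp hp_eq
  have hp_le : p ≤ fidelity (K * Kᴴ) (pinching P σ) := by
    have hmax := (isGreatest_sqrt_fidelity hK.1 (hP.posSemidef_pinching hσ.1)).2 ⟨Y, hblock, rfl⟩
    rw [hY, Complex.ofReal_re] at hmax
    exact (Real.sqrt_le_sqrt_iff (sq_nonneg _)).mp hmax
  refine ⟨p, hp, ⟨⟨σ, hσ, hp_le.antisymm (hP.fidelity_pinching_le hp.le hτ hle hσ)⟩, ?_⟩,
    ⟨hp.le, τ, hτ, hle⟩, ?_⟩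
  · rintro _ ⟨σ', hσ', rfl⟩
    exact hP.fidelity_pinching_le hp.le hτ hle hσ'
  · rintro l ⟨hl, τ', hτ', hle'⟩
    exact hp_le.trans (hP.fidelity_pinching_le hl hτ' hle' hσ)

end StrongDuality

section BlockDiagonal

variable {𝕜 J E : Type*} [RCLike 𝕜] [Finite J] [DecidableEq J] [Finite E]

theorem posSemidef_blockDiagonal_iff {D : J → Matrix E E 𝕜} :
    (blockDiagonal D).PosSemidef ↔ ∀ j, (D j).PosSemidef := by
  have := Fintype.ofFinite J
  have := Fintype.ofFinite E
  classical
  constructor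
  · intro h j
    convert h.submatrix fun e => (e, j)
    ext e e'
    rw [submatrix_apply, blockDiagonal_apply_eq]
  · intro h
    choose C hC using fun j => CStarAlgebra.nonneg_iff_eq_star_mul_self.mp (h j).nonneg
    have hD : blockDiagonal D = (blockDiagonal C)ᴴ * blockDiagonal C := by
      rw [blockDiagonal_conjTranspose, ← blockDiagonal_mul]
      exact congrArg blockDiagonal (funext hC)
    exact hD ▸ posSemidef_conjTranspose_mul_self _

theorem reindex_blockDiagonal_le_iff {D D' : J → Matrix E E 𝕜} :
    reindex (.prodComm E J) (.prodComm E J) (blockDiagonal D) ≤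
      reindex (.prodComm E J) (.prodComm E J) (blockDiagonal D') ↔ ∀ j, D j ≤ D' j := by
  have hsub : reindex (.prodComm E J) (.prodComm E J) (blockDiagonal D') -
      reindex (.prodComm E J) (.prodComm E J) (blockDiagonal D) =
      (blockDiagonal (D' - D)).submatrix (Equiv.prodComm E J).symm (Equiv.prodComm E J).symm := by
    rw [blockDiagonal_sub]
    rfl
  simp only [Matrix.le_iff, hsub, posSemidef_submatrix_equiv, posSemidef_blockDiagonal_iff,
    Pi.sub_apply]

end BlockDiagonal

section Purification

variable {X E : Type*} [Fintype E]

/-- The coefficient matrix of a vector of a bipartite system; its Gram matrices are, up to a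
transposition, the two reduced states. -/
def coeffMatrix (ψ : X × E → ℂ) : Matrix X E ℂ :=
  Matrix.of fun x e => ψ (x, e)

theorem isPurification_iff {ψ : X × E → ℂ} {ρ : Matrix X X ℂ} :
    IsPurification ψ ρ ↔ coeffMatrix ψ * (coeffMatrix ψ)ᴴ = ρ := by
  have htrace : traceRight (pureState ψ) = coeffMatrix ψ * (coeffMatrix ψ)ᴴ := by
    ext x x'
    simp only [traceRight, pureState, coeffMatrix, of_apply, mul_apply, conjTranspose_apply,
      vecMulVec_apply, Pi.star_apply]
  rw [IsPurification, htrace]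

theorem exists_isPurification [Fintype X] (hcard : Fintype.card X ≤ Fintype.card E)
    {ρ : Matrix X X ℂ} (hρ : ρ.PosSemidef) : ∃ ψ : X × E → ℂ, IsPurification ψ ρ := by
  classical
  obtain ⟨f⟩ := Function.Embedding.nonempty_of_card_le hcard
  obtain ⟨C, rfl⟩ := CStarAlgebra.nonneg_iff_eq_star_mul_self.mp hρ.nonneg
  let W : Matrix X E ℂ := (1 : Matrix E E ℂ).submatrix f id
  have hW : W * Wᴴ = 1 := by
    rw [conjTranspose_submatrix, conjTranspose_one,
      ← submatrix_mul _ _ _ _ _ Function.bijective_id, Matrix.one_mul,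
      submatrix_one f f.injective]
  refine ⟨fun q => (Cᴴ * W) q.1 q.2, isPurification_iff.mpr ?_⟩
  change Cᴴ * W * (Cᴴ * W)ᴴ = Cᴴ * C
  rw [conjTranspose_mul, conjTranspose_conjTranspose, Matrix.mul_assoc, ← Matrix.mul_assoc W, hW,
    Matrix.one_mul]

end Purification

section KeyEntropy

theorem keyIsometry_kronecker_mulVec {A B J E : Type*} [Fintype A] [Fintype B] [DecidableEq B]
    [Fintype E] [DecidableEq E] (Z : J → Matrix A A ℂ) (ψ : (A × B) × E → ℂ) (j : J)
    (x : A × B) (e : E) :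
    ((keyIsometry B Z ⊗ₖ (1 : Matrix E E ℂ)) *ᵥ ψ) ((j, x), e) =
      (onAB B Z j * coeffMatrix ψ) x e := by
  simp [mulVec, dotProduct, Fintype.sum_prod_type, keyIsometry, mul_apply, coeffMatrix, one_apply]

variable {A B J E : Type*} [Fintype A] [DecidableEq A] [Fintype B] [DecidableEq B]
  [Fintype J] {Z : J → Matrix A A ℂ}

theorem IsProjectiveMeasurement.onAB (hZ : IsProjectiveMeasurement Z) :
    IsProjectiveMeasurement (onAB B Z) where
  isStarProjection j :=
    { isIdempotentElem := by
        rw [IsIdempotentElem, QKD.onAB, ← mul_kronecker_mul, hZ.mul_self_eq, Matrix.mul_one]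
      isSelfAdjoint := by
        rw [IsSelfAdjoint, star_eq_conjTranspose, QKD.onAB, conjTranspose_kronecker,
          hZ.conjTranspose_eq, conjTranspose_one] }
  mul_eq_zero i j hij := by
    rw [QKD.onAB, QKD.onAB, ← mul_kronecker_mul, hZ.mul_eq_zero i j hij, zero_kronecker]
  sum_eq_one := by
    rw [← one_kronecker_one, ← hZ.sum_eq_one]
    ext
    simp only [QKD.onAB, Matrix.sum_apply, kroneckerMap_apply, Finset.sum_mul]

variable [Fintype E] [DecidableEq E] [DecidableEq J]

theorem keyEveState_eq_reindex_blockDiagonal (hZ : IsProjectiveMeasurement Z)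
    (ψ : (A × B) × E → ℂ) :
    keyEveState Z ψ = reindex (.prodComm E J) (.prodComm E J)
      (blockDiagonal fun j => ((coeffMatrix ψ)ᴴ * onAB B Z j * coeffMatrix ψ)ᵀ) := by
  have hP := hZ.onAB (B := B)
  ext ⟨j, e⟩ ⟨j', e'⟩
  have hentry : keyEveState Z ψ (j, e) (j', e') =
      ((onAB B Z j' * coeffMatrix ψ)ᴴ * (onAB B Z j * coeffMatrix ψ)) e' e := by
    simp only [keyEveState, pureState, traceMiddle, mul_vecMulVec, vecMulVec_mul,
      ← star_mulVec, of_apply, vecMulVec_apply, keyIsometry_kronecker_mulVec, Pi.star_apply,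
      mul_apply (M := (_)ᴴ), conjTranspose_apply, mul_comm]
  simp only [hentry, conjTranspose_mul, hP.conjTranspose_eq, Matrix.mul_assoc, reindex_apply,
    submatrix_apply, Equiv.prodComm_symm, Equiv.prodComm_apply, Prod.swap_prod_mk]
  rw [← Matrix.mul_assoc (QKD.onAB B Z j')]
  obtain rfl | hj := eq_or_ne j j'
  · rw [hP.mul_self_eq, blockDiagonal_apply_eq, transpose_apply]
  · rw [hP.mul_eq_zero j' j hj.symm, Matrix.zero_mul, Matrix.mul_zero,
      blockDiagonal_apply_ne _ _ _ hj, Matrix.zero_apply]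

theorem mem_minEntropyWitnesses_keyEveState (hZ : IsProjectiveMeasurement Z)
    (ψ : (A × B) × E → ℂ) (h : ℝ) :
    h ∈ minEntropyWitnesses (keyEveState Z ψ) ↔ ∃ τ, IsDensity τ ∧
      ∀ j, (coeffMatrix ψ)ᴴ * onAB B Z j * coeffMatrix ψ ≤ (2 : ℝ) ^ (-h) • τ := by
  have hle (σ : Matrix E E ℂ) :
      keyEveState Z ψ ≤ (2 : ℝ) ^ (-h) • ((1 : Matrix J J ℂ) ⊗ₖ σ) ↔
      ∀ j, (coeffMatrix ψ)ᴴ * onAB B Z j * coeffMatrix ψ ≤ (2 : ℝ) ^ (-h) • σᵀ := by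
    rw [keyEveState_eq_reindex_blockDiagonal hZ, ← kronecker_smul, one_kronecker,
      reindex_blockDiagonal_le_iff]
    simp only [Matrix.le_iff, ← posSemidef_transpose_iff (M := (2 : ℝ) ^ (-h) • σᵀ - _),
      transpose_sub, transpose_smul, transpose_transpose]
  constructor
  · rintro ⟨σ, hσ, hσ_le⟩
    exact ⟨σᵀ, ⟨hσ.1.transpose, by rw [trace_transpose, hσ.2]⟩, (hle σ).mp hσ_le⟩
  · rintro ⟨τ, hτ, hτ_le⟩
    exact ⟨τᵀ, ⟨hτ.1.transpose, by rw [trace_transpose, hτ.2]⟩, (hle τᵀ).mpr hτ_le⟩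

theorem isGreatest_neg_logb_of_isLeast {S : Set ℝ} {p : ℝ} (hp : 0 < p) (h : IsLeast S p) :
    IsGreatest {h : ℝ | (2 : ℝ) ^ (-h) ∈ S} (-Real.logb 2 p) := by
  constructor
  · rw [Set.mem_ofPred_eq, neg_neg, Real.rpow_logb two_pos (by norm_num) hp]
    exact h.1
  · intro x hx
    exact le_neg_of_le_neg ((Real.logb_le_iff_le_rpow one_lt_two hp).mpr (h.2 hx))

theorem keyMinEntropy_eq_neg_logb (hZ : IsProjectiveMeasurement Z)
    {ρ : Matrix (A × B) (A × B) ℂ} {ψ : (A × B) × E → ℂ} (hρ : IsDensity ρ)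
    (hψ : IsPurification ψ ρ) :
    IsGreatest (minEntropyWitnesses (keyEveState Z ψ)) (keyMinEntropy Z ψ) ∧
      ∃ p : ℝ, 0 < p ∧ IsGreatest {f | ∃ σ, IsDensity σ ∧ f = fidelity ρ (pinch Z σ)} p ∧
        keyMinEntropy Z ψ = -Real.logb 2 p := by
  obtain rfl := isPurification_iff.mp hψ
  obtain ⟨p, hp, hmax, hmin⟩ := (hZ.onAB (B := B)).exists_isGreatest_fidelity_pinching hρ
  have hwit : minEntropyWitnesses (keyEveState Z ψ) = {h : ℝ | (2 : ℝ) ^ (-h) ∈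
      {l : ℝ | 0 ≤ l ∧ ∃ τ, IsDensity τ ∧
        ∀ j, (coeffMatrix ψ)ᴴ * onAB B Z j * coeffMatrix ψ ≤ l • τ}} := by
    ext h
    simp only [mem_minEntropyWitnesses_keyEveState hZ, Set.mem_ofPred_eq,
      (Real.rpow_pos_of_pos two_pos _).le, true_and]
  have hgreatest : IsGreatest (minEntropyWitnesses (keyEveState Z ψ)) (-Real.logb 2 p) :=
    hwit ▸ isGreatest_neg_logb_of_isLeast hp hmin
  have hkey : keyMinEntropy Z ψ = -Real.logb 2 p := hgreatest.csSup_eq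
  exact ⟨hkey ▸ hgreatest, p, hp, hmax, hkey⟩

end KeyEntropy

section Attainment

variable {X J : Type*} [Fintype X]

theorem isCompact_setOf_isDensity : IsCompact {ρ : Matrix X X ℂ | IsDensity ρ} := by
  classical
  have htrace : IsClosed {ρ : Matrix X X ℂ | ρ.trace = 1} :=
    isClosed_eq (by fun_prop) continuous_const
  convert isCompact_Icc_zero_one.inter_right htrace using 1
  ext ρ
  refine ⟨fun hρ => ⟨⟨hρ.1.nonneg, ?_⟩, hρ.2⟩, fun hρ => ⟨hρ.1.1.posSemidef, hρ.2⟩⟩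
  simpa only [hρ.2, Complex.one_re, one_smul] using le_re_trace_smul_one hρ.1

theorem isCompact_constraintSet {ι : Type*} (Γ : ι → Matrix X X ℂ) (γLB γUB : ι → ℝ) :
    IsCompact (constraintSet Γ γLB γUB) := by
  refine isCompact_setOf_isDensity.inter_right (t := {ρ | ∀ i, _ ∧ _}) ?_
  simp only [Set.ofPred_forall, Set.ofPred_and]
  exact isClosed_iInter fun i => (isClosed_le continuous_const (by fun_prop)).inter
    (isClosed_le (by fun_prop) continuous_const)

variable [DecidableEq X] [Fintype J]

open scoped Matrix.Norms.L2Operator in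
theorem continuousOn_matrix_sqrt :
    ContinuousOn CFC.sqrt {M : Matrix X X ℂ | M.PosSemidef} := by
  simpa only [Matrix.nonneg_iff_posSemidef] using
    CFC.continuousOn_sqrt (A := Matrix X X ℂ)

theorem continuousOn_sqrt_fidelity :
    ContinuousOn (fun q : Matrix X X ℂ × Matrix X X ℂ => √(fidelity q.1 q.2))
      {q | q.1.PosSemidef ∧ q.2.PosSemidef} := by
  simp only [sqrt_fidelity]
  have hsqrt : ContinuousOn (fun q : Matrix X X ℂ × Matrix X X ℂ => CFC.sqrt q.1)
      {q | q.1.PosSemidef ∧ q.2.PosSemidef} :=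
    continuousOn_matrix_sqrt.comp continuousOn_fst fun _ hq => hq.1
  have hconj : ContinuousOn (fun q : Matrix X X ℂ × Matrix X X ℂ =>
      CFC.sqrt (CFC.sqrt q.1 * q.2 * CFC.sqrt q.1)) {q | q.1.PosSemidef ∧ q.2.PosSemidef} := by
    refine continuousOn_matrix_sqrt.comp ((hsqrt.mul continuousOn_snd).mul hsqrt) fun q hq => ?_
    have hsandwich := hq.2.mul_mul_conjTranspose_same (CFC.sqrt q.1)
    rwa [conjTranspose_sqrt] at hsandwich
  exact Complex.continuous_re.comp_continuousOn
    (continuous_id.matrix_trace.comp_continuousOn hconj)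

/-- The values of the root fidelity between a state in `C` and a pinched state, over which the
key-rate optimization takes its maximum. -/
def sqrtFidelityValues (P : J → Matrix X X ℂ) (C : Set (Matrix X X ℂ)) : Set ℝ :=
  {f | ∃ ρ ∈ C, ∃ σ, IsDensity σ ∧ f = √(fidelity ρ (pinching P σ))}

theorem IsProjectiveMeasurement.exists_isGreatest_sqrtFidelityValues {P : J → Matrix X X ℂ}
    (hP : IsProjectiveMeasurement P) {C : Set (Matrix X X ℂ)} (hC : IsCompact C)
    (hne : C.Nonempty) (hdens : ∀ ρ ∈ C, IsDensity ρ) :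
    ∃ M, IsGreatest (sqrtFidelityValues P C) M := by
  have himage : sqrtFidelityValues P C =
      (fun q : Matrix X X ℂ × Matrix X X ℂ => √(fidelity q.1 (pinching P q.2))) ''
        (C ×ˢ {σ | IsDensity σ}) := by
    ext f
    simp [sqrtFidelityValues, and_assoc, eq_comm]
  have hpinching : Continuous (pinching P) := by
    unfold pinching
    fun_prop
  have hpair : ContinuousOn (fun q : Matrix X X ℂ × Matrix X X ℂ => (q.1, pinching P q.2))
      (C ×ˢ {σ | IsDensity σ}) := by
    fun_prop
  have hcont := continuousOn_sqrt_fidelity.comp hpair fun q hq =>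
    ⟨(hdens _ hq.1).1, hP.posSemidef_pinching hq.2.1⟩
  have hprod : (C ×ˢ {σ | IsDensity σ}).Nonempty :=
    hne.prod (hne.imp hdens)
  rw [himage]
  exact ((hC.prod isCompact_setOf_isDensity).image_of_continuousOn hcont).exists_isGreatest
    (hprod.image _)

end Attainment

section MinimalEntropy

variable {A B J : Type*} [Fintype A] [DecidableEq A] [Fintype B] [DecidableEq B]
  [Fintype J] {Z : J → Matrix A A ℂ} {C : Set (Matrix (A × B) (A × B) ℂ)} {M : ℝ}

theorem exists_isGreatest_sqrtFidelityValues_singleton {E : Type*} [Fintype E] [DecidableEq E]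
    [DecidableEq J] (hZ : IsProjectiveMeasurement Z) {ρ : Matrix (A × B) (A × B) ℂ}
    {ψ : (A × B) × E → ℂ} (hρ : IsDensity ρ) (hψ : IsPurification ψ ρ) :
    ∃ m, 0 < m ∧ IsGreatest (sqrtFidelityValues (onAB B Z) {ρ}) m ∧
      keyMinEntropy Z ψ = -2 * Real.logb 2 m := by
  obtain ⟨-, p, hp, ⟨⟨σ, hσ, hpσ⟩, hp_max⟩, hkey⟩ := keyMinEntropy_eq_neg_logb hZ hρ hψ
  refine ⟨√p, Real.sqrt_pos.mpr hp, ⟨⟨ρ, rfl, σ, hσ, congrArg Real.sqrt hpσ⟩, ?_⟩, ?_⟩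
  · rintro _ ⟨_, rfl, τ, hτ, rfl⟩
    exact Real.sqrt_le_sqrt (hp_max ⟨τ, hτ, rfl⟩)
  · rw [hkey, Real.sqrt_eq_rpow, Real.logb_rpow_eq_mul_logb_of_pos hp]
    ring

theorem pos_of_isGreatest_sqrtFidelityValues (hZ : IsProjectiveMeasurement Z)
    (hdens : ∀ ρ ∈ C, IsDensity ρ) (hM : IsGreatest (sqrtFidelityValues (onAB B Z) C) M) :
    0 < M := by
  obtain ⟨ρ, hρ, -⟩ := hM.1
  obtain ⟨ψ, hψ⟩ := exists_isPurification (E := A × B) le_rfl (hdens ρ hρ).1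
  classical
  obtain ⟨m, hm, ⟨⟨_, rfl, σ, hσ, rfl⟩, -⟩, -⟩ :=
    exists_isGreatest_sqrtFidelityValues_singleton hZ (hdens ρ hρ) hψ
  exact hm.trans_le (hM.2 ⟨_, hρ, σ, hσ, rfl⟩)

variable [DecidableEq J]

theorem neg_two_mul_logb_le_keyMinEntropy {E : Type*} [Fintype E] [DecidableEq E]
    (hZ : IsProjectiveMeasurement Z) (hdens : ∀ ρ ∈ C, IsDensity ρ)
    (hM : IsGreatest (sqrtFidelityValues (onAB B Z) C) M) {ρ : Matrix (A × B) (A × B) ℂ}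
    (hρ : ρ ∈ C) {ψ : (A × B) × E → ℂ} (hψ : IsPurification ψ ρ) :
    -2 * Real.logb 2 M ≤ keyMinEntropy Z ψ := by
  obtain ⟨m, hm, ⟨⟨_, rfl, σ, hσ, rfl⟩, -⟩, hkey⟩ :=
    exists_isGreatest_sqrtFidelityValues_singleton hZ (hdens ρ hρ) hψ
  rw [hkey]
  exact mul_le_mul_of_nonpos_left
    (Real.logb_le_logb_of_le one_lt_two hm (hM.2 ⟨_, hρ, σ, hσ, rfl⟩)) (by norm_num)

theorem isLeast_keyMinEntropyValues {E : Type*} [Fintype E] [DecidableEq E]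
    (hZ : IsProjectiveMeasurement Z) (hdens : ∀ ρ ∈ C, IsDensity ρ)
    (hcard : Fintype.card (A × B) ≤ Fintype.card E)
    (hM : IsGreatest (sqrtFidelityValues (onAB B Z) C) M) :
    IsLeast (keyMinEntropyValues E Z C) (-2 * Real.logb 2 M) := by
  constructor
  · obtain ⟨ρ, hρ, σ, hσ, hMσ⟩ := hM.1
    obtain ⟨ψ, hψ⟩ := exists_isPurification hcard (hdens ρ hρ).1
    obtain ⟨m, -, hm, hkey⟩ :=
      exists_isGreatest_sqrtFidelityValues_singleton hZ (hdens ρ hρ) hψ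
    have hM_singleton : IsGreatest (sqrtFidelityValues (onAB B Z) {ρ}) M :=
      ⟨⟨ρ, rfl, σ, hσ, hMσ⟩, fun _ ⟨_, hρ', h⟩ => hM.2 ⟨ρ, hρ, hρ' ▸ h⟩⟩
    exact ⟨ρ, hρ, ψ, hψ, hM_singleton.unique hm ▸ hkey.symm⟩
  · rintro _ ⟨ρ, hρ, ψ, hψ, rfl⟩
    exact neg_two_mul_logb_le_keyMinEntropy hZ hdens hM hρ hψ

end MinimalEntropy

section Programs

theorem primalObjective_eq {X : Type*} [Fintype X] (Y : Matrix X X ℂ) :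
    primalObjective Y = Y.trace.re := by
  rw [primalObjective, trace_conjTranspose, Complex.star_def, Complex.add_conj]
  simp

theorem posSemidef_fromBlocks_mono {X : Type*} [Finite X] {ρ ρ' σ σ' Y : Matrix X X ℂ}
    (h : (fromBlocks ρ Y Yᴴ σ).PosSemidef) (hρ : ρ ≤ ρ') (hσ : σ ≤ σ') :
    (fromBlocks ρ' Y Yᴴ σ').PosSemidef := by
  have := Fintype.ofFinite X
  classical
  have hdiag : (fromBlocks (ρ' - ρ) 0 0ᴴ (σ' - σ)).PosSemidef :=
    posSemidef_fromBlocks_iff_exists_contraction (Matrix.le_iff.mp hρ) (Matrix.le_iff.mp hσ)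
      |>.mpr ⟨0, by simp, by simp⟩
  convert hdiag.add h using 1
  rw [conjTranspose_zero, fromBlocks_add, sub_add_cancel, sub_add_cancel, zero_add, zero_add]

theorem trace_fromBlocks {R m n : Type*} [AddCommMonoid R] [Fintype m] [Fintype n]
    (P : Matrix m m R) (Q : Matrix m n R) (Q' : Matrix n m R) (S : Matrix n n R) :
    (fromBlocks P Q Q' S).trace = P.trace + S.trace := by
  simp [trace]

theorem re_trace_le_of_half_smul_fromBlocks_le {X : Type*} [Fintype X] [DecidableEq X]
    {ρ σ Y Y₁₁ Y₂₂ : Matrix X X ℂ} (hblock : (fromBlocks ρ Y Yᴴ σ).PosSemidef)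
    (hdual : (1 / 2 : ℝ) • fromBlocks 0 1 1 0 ≤ fromBlocks Y₁₁ 0 0 Y₂₂) :
    Y.trace.re ≤ (Y₁₁ * ρ).trace.re + (Y₂₂ * σ).trace.re := by
  have hoff : (fromBlocks Yᴴ σ ρ Y).trace.re = 2 * Y.trace.re := by
    rw [trace_fromBlocks, trace_conjTranspose, Complex.add_re, Complex.star_def, Complex.conj_re,
      two_mul]
  have h := Complex.re_le_re (trace_mul_mono hdual hblock)
  simp only [Matrix.smul_mul, trace_smul, fromBlocks_multiply, Matrix.zero_mul, Matrix.one_mul,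
    zero_add, add_zero, Complex.smul_re, smul_eq_mul] at h
  rw [hoff, trace_fromBlocks, Complex.add_re] at h
  linarith

variable {A B J ι : Type*} [Fintype A] [Fintype B] [DecidableEq B]
  [Fintype J] {Z : J → Matrix A A ℂ} {Γ : ι → Matrix (A × B) (A × B) ℂ} {γLB γUB : ι → ℝ}
  {ρ σ : Matrix (A × B) (A × B) ℂ}

theorem PrimalFeasible.mem_constraintSet {X₁₁ X₁₂ X₂₂ : Matrix (A × B) (A × B) ℂ}
    (h : PrimalFeasible Z Γ γLB γUB ρ σ X₁₁ X₁₂ X₂₂) : ρ ∈ constraintSet Γ γLB γUB :=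
  ⟨⟨h.rho_nonneg.posSemidef, h.trace_rho⟩, fun i => ⟨h.lower i, h.upper i⟩⟩

theorem PrimalFeasible.posSemidef_fromBlocks {X₁₁ X₁₂ X₂₂ : Matrix (A × B) (A × B) ℂ}
    (h : PrimalFeasible Z Γ γLB γUB ρ σ X₁₁ X₁₂ X₂₂) :
    (fromBlocks ρ X₁₂ X₁₂ᴴ (pinch Z σ)).PosSemidef :=
  posSemidef_fromBlocks_mono h.block.posSemidef h.le_rho h.le_pinch

variable [DecidableEq A]

theorem isGreatest_sqrt_fidelity_pinch (hZ : IsProjectiveMeasurement Z) (hρ : ρ.PosSemidef)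
    (hσ : σ.PosSemidef) :
    IsGreatest {f | ∃ X, (fromBlocks ρ X Xᴴ (pinch Z σ)).PosSemidef ∧ f = X.trace.re}
      √(fidelity ρ (pinch Z σ)) :=
  isGreatest_sqrt_fidelity hρ (hZ.onAB.posSemidef_pinching hσ)

theorem isGreatest_primalObjective (hZ : IsProjectiveMeasurement Z) {M : ℝ}
    (hM : IsGreatest (sqrtFidelityValues (onAB B Z) (constraintSet Γ γLB γUB)) M) :
    IsGreatest {f | ∃ ρ σ X₁₁ X₁₂ X₂₂, PrimalFeasible Z Γ γLB γUB ρ σ X₁₁ X₁₂ X₂₂ ∧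
      f = primalObjective X₁₂} M := by
  simp only [primalObjective_eq]
  constructor
  · obtain ⟨ρ, hρ, σ, hσ, rfl⟩ := hM.1
    obtain ⟨Y, hY, hY_eq⟩ := (isGreatest_sqrt_fidelity_pinch hZ hρ.1.1 hσ.1).1
    exact ⟨ρ, σ, ρ, Y, pinch Z σ, ⟨le_rfl, le_rfl, fun i => (hρ.2 i).2, fun i => (hρ.2 i).1,
      hρ.1.2, hσ.2, hY.nonneg, hρ.1.1.nonneg, hσ.1.nonneg⟩, hY_eq⟩
  · rintro _ ⟨ρ, σ, X₁₁, X₁₂, X₂₂, h, rfl⟩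
    have hρ := h.mem_constraintSet
    have hσ : IsDensity σ := ⟨h.sigma_nonneg.posSemidef, h.trace_sigma⟩
    have hmax := isGreatest_sqrt_fidelity_pinch hZ hρ.1.1 hσ.1
    exact (hmax.2 ⟨X₁₂, h.posSemidef_fromBlocks, rfl⟩).trans (hM.2 ⟨ρ, hρ, σ, hσ, rfl⟩)

variable [Fintype ι] {z ybar : ℝ} {x y : ι → ℝ} {Y₁₁ Y₂₂ : Matrix (A × B) (A × B) ℂ}

theorem DualFeasible.re_trace_mul_le (hY : DualFeasible Z Γ z ybar x y Y₁₁ Y₂₂)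
    (hρ : ρ ∈ constraintSet Γ γLB γUB) :
    (Y₁₁ * ρ).trace.re ≤ ybar + ∑ i, (y i * γUB i - x i * γLB i) := by
  calc (Y₁₁ * ρ).trace.re
      ≤ ((∑ i, (y i - x i) • Γ i + ybar • (1 : Matrix (A × B) (A × B) ℂ)) * ρ).trace.re :=
        Complex.re_le_re (trace_mul_mono hY.le_sum hρ.1.1)
    _ = ybar + ∑ i, (y i - x i) * (ρ * Γ i).trace.re := by
        simp only [Matrix.add_mul, Matrix.sum_mul, smul_mul, Matrix.one_mul, trace_add, trace_sum,
          trace_smul, hρ.1.2, Complex.add_re, Complex.re_sum, Complex.smul_re, smul_eq_mul,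
          Complex.one_re, mul_one, trace_mul_comm ρ, add_comm]
    _ ≤ ybar + ∑ i, (y i * γUB i - x i * γLB i) := by
        gcongr with i
        have hupper := mul_le_mul_of_nonneg_left (hρ.2 i).2 (hY.y_nonneg i)
        have hlower := mul_le_mul_of_nonneg_left (hρ.2 i).1 (hY.x_nonneg i)
        linarith

theorem DualFeasible.re_trace_mul_pinch_le (hY : DualFeasible Z Γ z ybar x y Y₁₁ Y₂₂)
    (hσ : IsDensity σ) : (Y₂₂ * pinch Z σ).trace.re ≤ z :=
  calc (Y₂₂ * pinch Z σ).trace.re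
      = (pinch Z Y₂₂ * σ).trace.re := by
        exact congrArg Complex.re (trace_pinching_mul (onAB B Z) Y₂₂ σ).symm
    _ ≤ (z • (1 : Matrix (A × B) (A × B) ℂ) * σ).trace.re :=
        Complex.re_le_re (trace_mul_mono hY.pinch_le hσ.1)
    _ = z := by
        rw [smul_mul, Matrix.one_mul, trace_smul, hσ.2, Complex.smul_re, Complex.one_re,
          smul_eq_mul, mul_one]

theorem DualFeasible.sqrt_fidelity_le_dualObjective (hZ : IsProjectiveMeasurement Z)
    (hY : DualFeasible Z Γ z ybar x y Y₁₁ Y₂₂) (hρ : ρ ∈ constraintSet Γ γLB γUB)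
    (hσ : IsDensity σ) :
    √(fidelity ρ (pinch Z σ)) ≤ dualObjective γLB γUB z ybar x y := by
  obtain ⟨X, hX, hX_eq⟩ := (isGreatest_sqrt_fidelity_pinch hZ hρ.1.1 hσ.1).1
  have hblock := re_trace_le_of_half_smul_fromBlocks_le hX hY.block
  have hρ_le := hY.re_trace_mul_le hρ
  have hσ_le := hY.re_trace_mul_pinch_le hσ
  rw [hX_eq, dualObjective]
  linarith

theorem keyRate_mono (n N : ℕ) (leak εPA εcor : ℝ) : Monotone (keyRate n N leak εPA εcor) := by
  intro h h' hh
  unfold keyRate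
  gcongr

end Programs

end QKD

theorem mainTheorem3 {A B J ι : Type*} [Fintype A] [DecidableEq A] [Fintype B] [DecidableEq B]
    [Fintype J] [DecidableEq J] [Fintype ι]
    (Z : J → Matrix A A ℂ) (hZ : QKD.IsProjectiveMeasurement Z)
    (Γ : ι → Matrix (A × B) (A × B) ℂ) (hΓ : ∀ i, (Γ i).IsHermitian)
    (γLB γUB : ι → ℝ) (hC : (QKD.constraintSet Γ γLB γUB).Nonempty) :
    -- the min-entropy of a single state, for every purification held by Eve
    (∀ (E : Type*) [Fintype E] [DecidableEq E] (ρ : Matrix (A × B) (A × B) ℂ)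
        (ψ : (A × B) × E → ℂ), QKD.IsDensity ρ → QKD.IsPurification ψ ρ →
        IsGreatest (QKD.minEntropyWitnesses (QKD.keyEveState Z ψ)) (QKD.keyMinEntropy Z ψ) ∧
        ∃ m : ℝ,
          IsGreatest {f | ∃ σ, QKD.IsDensity σ ∧ f = QKD.fidelity ρ (QKD.pinch Z σ)} m ∧
          QKD.keyMinEntropy Z ψ = -Real.logb 2 m) ∧
    -- `g` is the minimum of the min-entropy over the constraint set
    ∃ g : ℝ,
      (∀ (E : Type*) [Fintype E] [DecidableEq E],
        Fintype.card (A × B) ≤ Fintype.card E →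
        IsLeast (QKD.keyMinEntropyValues E Z (QKD.constraintSet Γ γLB γUB)) g) ∧
      -- `g` through the maximal fidelity
      (∃ M : ℝ,
        IsGreatest {f | ∃ ρ ∈ QKD.constraintSet Γ γLB γUB, ∃ σ, QKD.IsDensity σ ∧
          f = √(QKD.fidelity ρ (QKD.pinch Z σ))} M ∧
        g = -2 * Real.logb 2 M ∧ (2 : ℝ) ^ (-g / 2) = M) ∧
      -- the primal program has optimal value `2^{-g/2}`
      IsGreatest {f | ∃ ρ σ X₁₁ X₁₂ X₂₂, QKD.PrimalFeasible Z Γ γLB γUB ρ σ X₁₁ X₁₂ X₂₂ ∧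
        f = QKD.primalObjective X₁₂} ((2 : ℝ) ^ (-g / 2)) ∧
      -- every feasible point of the dual program gives reliable bounds
      ∀ (z ybar : ℝ) (x y : ι → ℝ) (Y₁₁ Y₂₂ : Matrix (A × B) (A × B) ℂ),
        QKD.DualFeasible Z Γ z ybar x y Y₁₁ Y₂₂ →
        (2 : ℝ) ^ (-g / 2) ≤ QKD.dualObjective γLB γUB z ybar x y ∧
        -2 * Real.logb 2 (QKD.dualObjective γLB γUB z ybar x y) ≤ g ∧
        ∀ (E : Type*) [Fintype E] [DecidableEq E], ∀ ρ ∈ QKD.constraintSet Γ γLB γUB,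
          ∀ ψ : (A × B) × E → ℂ, QKD.IsPurification ψ ρ →
          -2 * Real.logb 2 (QKD.dualObjective γLB γUB z ybar x y) ≤ QKD.keyMinEntropy Z ψ ∧
          ∀ (n N : ℕ) (leak εPA εcor : ℝ), 0 < n → n ≤ N → 0 < εPA → 0 < εcor →
            QKD.keyRate n N leak εPA εcor
                (-2 * Real.logb 2 (QKD.dualObjective γLB γUB z ybar x y)) ≤
              QKD.keyRate n N leak εPA εcor (QKD.keyMinEntropy Z ψ) := by
  have hdens : ∀ ρ ∈ QKD.constraintSet Γ γLB γUB, QKD.IsDensity ρ := fun ρ hρ => hρ.1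
  obtain ⟨M, hM⟩ := (hZ.onAB (B := B)).exists_isGreatest_sqrtFidelityValues
    (QKD.isCompact_constraintSet Γ γLB γUB) hC hdens
  have hM_pos := QKD.pos_of_isGreatest_sqrtFidelityValues hZ hdens hM
  have hpow : (2 : ℝ) ^ (-(-2 * Real.logb 2 M) / 2) = M := by
    rw [neg_mul, neg_neg, mul_div_cancel_left₀ _ two_ne_zero,
      Real.rpow_logb two_pos (by norm_num) hM_pos]
  refine ⟨fun E _ _ ρ ψ hρ hψ => ?_, -2 * Real.logb 2 M,
    fun E _ _ hcard => QKD.isLeast_keyMinEntropyValues hZ hdens hcard hM,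
    ⟨M, hM, rfl, hpow⟩, hpow.symm ▸ QKD.isGreatest_primalObjective hZ hM,
    fun z ybar x y Y₁₁ Y₂₂ hY => ?_⟩
  · obtain ⟨hwit, p, -, hp, hkey⟩ := QKD.keyMinEntropy_eq_neg_logb hZ hρ hψ
    exact ⟨hwit, p, hp, hkey⟩
  · obtain ⟨ρ₀, hρ₀, σ₀, hσ₀, hMσ₀⟩ := hM.1
    have hM_le := hMσ₀.trans_le (hY.sqrt_fidelity_le_dualObjective hZ hρ₀ hσ₀)
    have hlog := mul_le_mul_of_nonpos_left (Real.logb_le_logb_of_le one_lt_two hM_pos hM_le)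
      (neg_nonpos.mpr zero_le_two)
    refine ⟨hpow.trans_le hM_le, hlog, fun E _ _ ρ hρ ψ hψ => ?_⟩
    have hkey := hlog.trans (QKD.neg_two_mul_logb_le_keyMinEntropy hZ hdens hM hρ hψ)
    exact ⟨hkey, fun n N leak εPA εcor _ _ _ _ => QKD.keyRate_mono n N leak εPA εcor hkey⟩
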